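/- Let $q_0,q_1,q_2$ be the vertices of an equilateral triangle in the plane, let $F_i$ be the homothety with fixed point $q_i$ and ratio $1/2$, and let $\mathcal{SG}$ be the Sierpinski gasket, the unique nonempty compact set with $\mathcal{SG}=\bigcup_{i=0}^2F_i(\mathcal{SG})$. Put $V_0=\{q_0,q_1,q_2\}$, $V_{m+1}=\bigcup_iF_i(V_m)$, and $F_w=F_{w_1}\circ\cdots\circ F_{w_k}$ for a word $w=(w_1,\dots,w_k)$ with letters in $\{0,1,2\}$; the set $C_w=F_w(\mathcal{SG})$ is called a cell of level $k$. Let $\mu$ be the self-similar probability measure on $\mathcal{SG}$ that gives mass $3^{-k}$ to every cell of level $k$, and write $M_B(u)=\mu(B)^{-1}\int_B u\,d\mu$. Let $\Gamma_m$ be the graph with vertex set $V_m$ in which two distinct points are joined, $x\sim_m y$, if they both lie in $F_w(V_0)$ for some word $w$ of length $m$. Let $\mathcal E(u,v)=\lim_{m\to\infty}(5/3)^m\sum_{x\sim_m y}(u(x)-u(y))(v(x)-v(y))$ (sum over the edges of $\Gamma_m$), and let $\mathrm{dom}\,\mathcal E$ be the space of continuous functions $u$ on $\mathcal{SG}$ with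 $\mathcal E(u,u)<\infty$. One says that $\Delta u=f$ if $f$ is continuous on $\mathcal{SG}$, $u\in\mathrm{dom}\,\mathcal E$, and $\mathcal E(u,\varphi)=-\int f\varphi\,d\mu$ for all $\varphi\in\mathrm{dom}\,\mathcal E$ that vanish on $V_0$. A continuous function $h$ on $\mathcal{SG}$ is harmonic if $h(x)=\frac14\sum_{y\sim_m x}h(y)$ for all $m$ and all $x\in V_m\setminus V_0$. Let $x\in\mathcal{SG}\setminus V_0$. A $k$ level mean value neighborhood of $x$ is a measurable set $B$ for which there is a cell $C_w$ of level $k$ with $x\in C_w$, $C_w\cap V_0=\emptyset$ and $C_w\subseteq B\subseteq D_w$, where $D_w$ is the union of $C_w$ and its neighboring cells of level $k$ (those that meet $C_w$), such that $M_B(h)=h(x)$ for every harmonic function $h$ on $\mathcal{SG}$. **Theorem 4.1.** There are functions $v$ on $\mathcal{SG}$ with $\Delta v=1$, and there are constants $c_0>0$ and $c_1$ such that, for every such $v$, every $x\in\mathcal{SG}\setminus V_0$, every $k$ and every $k$ level mean value neighborhood $B$ of $x$, the number $c_B=M_B(v)-v(x)$ satisfies $$c_0\,5^{-k}\le c_B\le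 c_1\,5^{-k}.$$ -/

import Mathlib

open MeasureTheory Filter Topology

noncomputable section

namespace SierpinskiGasket

/-- The Euclidean plane. -/
abbrev Plane : Type := EuclideanSpace ℝ (Fin 2)

/-- The points `q 0, q 1, q 2` are the vertices of a (nondegenerate) equilateral triangle. -/
def IsEquilateral (q : Fin 3 → Plane) : Prop :=
  ∃ s : ℝ, 0 < s ∧ ∀ i j, i ≠ j → dist (q i) (q j) = s

/-- The homothety `F_i` with fixed point `q i` and ratio `1/2`. -/
def F (q : Fin 3 → Plane) (i : Fin 3) (x : Plane) : Plane :=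
  q i + (1 / 2 : ℝ) • (x - q i)

/-- `F_w = F_{w_1} ∘ ⋯ ∘ F_{w_m}` for a word `w = [w_1, …, w_m]`. -/
def Fword (q : Fin 3 → Plane) : List (Fin 3) → Plane → Plane
  | [] => id
  | i :: w => F q i ∘ Fword q w

/-- The point with address `ω`, that is, the limit of `F_{ω_0} ∘ ⋯ ∘ F_{ω_n} (x)` as `n → ∞`. -/
def coding (q : Fin 3 → Plane) (ω : ℕ → Fin 3) : Plane :=
  ∑' n : ℕ, (1 / 2 : ℝ) ^ (n + 1) • q (ω n)

/-- The Sierpinski gasket: the attractor of `F_0, F_1, F_2`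
(see `isCompact_SG`, `SG_nonempty`, `SG_eq_iUnion` below for its characterization). -/
def SG (q : Fin 3 → Plane) : Set Plane := Set.range (coding q)

/-- The cell `F_w(SG)`; it is an `m`-cell if `w` has length `m`. -/
def cell (q : Fin 3 → Plane) (w : List (Fin 3)) : Set Plane := Fword q w '' SG q

/-- The self-similar probability measure with weights `1/3, 1/3, 1/3`: the law of the point whose
address is a sequence of independent uniformly distributed letters. It gives mass `3^{-m}` to every
`m`-cell. -/
def μ (q : Fin 3 → Plane) : Measure Plane :=
  (Measure.infinitePi fun _ : ℕ => (PMF.uniformOfFintype (Fin 3)).toMeasure).map (coding q)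

/-- The vertex set `V_m`; `V_0 = {q_0, q_1, q_2}` is the boundary. -/
def V (q : Fin 3 → Plane) : ℕ → Finset Plane
  | 0 => by classical exact Finset.univ.image q
  | m + 1 => by classical exact Finset.univ.biUnion fun i => (V q m).image (F q i)

/-- The edge relation `x ∼_m y` of the graph `Γ_m`: `x` and `y` are distinct boundary points of a
common `m`-cell. -/
def Adj (q : Fin 3 → Plane) (m : ℕ) (x y : Plane) : Prop :=
  x ≠ y ∧ ∃ w : List (Fin 3), w.length = m ∧
    (∃ i, x = Fword q w (q i)) ∧ (∃ j, y = Fword q w (q j))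

/-- The neighbors of `x` in `Γ_m`. -/
def nbrs (q : Fin 3 → Plane) (m : ℕ) (x : Plane) : Finset Plane := by
  classical exact (V q m).filter (Adj q m x)

/-- The (polarized) renormalized graph energy
`𝓔_m(u, v) = (3/5)^{-m} ∑_{edges x ∼_m y} (u x - u y) (v x - v y)`. The factor `1/2` is there because
the double sum meets every edge twice. -/
def graphEnergy (q : Fin 3 → Plane) (m : ℕ) (u v : Plane → ℝ) : ℝ :=
  ((3 / 5 : ℝ) ^ m)⁻¹ *
    ((1 / 2) * ∑ x ∈ V q m, ∑ y ∈ nbrs q m x, (u x - u y) * (v x - v y))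

/-- `u ∈ dom 𝓔`: `u` is continuous on `SG` and `𝓔(u) = lim 𝓔_m(u, u)` is finite.
(Functions on `SG` are represented by functions on the plane whose values off `SG` are irrelevant.) -/
def DomE (q : Fin 3 → Plane) (u : Plane → ℝ) : Prop :=
  ContinuousOn u (SG q) ∧ ∃ e : ℝ, Tendsto (fun m => graphEnergy q m u u) atTop (𝓝 e)

/-- `u ∈ dom₀ 𝓔`: `u ∈ dom 𝓔` and `u` vanishes on `V_0`. -/
def DomE₀ (q : Fin 3 → Plane) (u : Plane → ℝ) : Prop :=
  DomE q u ∧ ∀ x ∈ V q 0, u x = 0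

/-- `u ∈ dom Δ` with `Δ u = f` (weak formulation): `f` is continuous, `u ∈ dom 𝓔`, and
`𝓔(u, φ) = lim 𝓔_m(u, φ)` equals `-∫ f φ dμ` for all `φ ∈ dom₀ 𝓔`. -/
def HasLaplacian (q : Fin 3 → Plane) (u f : Plane → ℝ) : Prop :=
  ContinuousOn f (SG q) ∧ DomE q u ∧
    ∀ φ, DomE₀ q φ →
      Tendsto (fun m => graphEnergy q m u φ) atTop (𝓝 (-∫ y, f y * φ y ∂(μ q)))

/-- Harmonic functions on `SG`: continuous functions with the discrete mean value property
`h x = (1/4) ∑_{y ∼_m x} h y` at all nonboundary vertices of all the graphs `Γ_m`. -/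
def IsHarmonic (q : Fin 3 → Plane) (h : Plane → ℝ) : Prop :=
  ContinuousOn h (SG q) ∧
    ∀ m, ∀ x ∈ V q m, x ∉ V q 0 → h x = (1 / 4) * ∑ y ∈ nbrs q m x, h y

/-- The mean value `M_B(u) = μ(B)⁻¹ ∫_B u dμ`. -/
def mean (q : Fin 3 → Plane) (B : Set Plane) (u : Plane → ℝ) : ℝ :=
  ((μ q).real B)⁻¹ * ∫ y in B, u y ∂(μ q)

/-- `D_w`: the union of the cell `C_w` and its neighboring cells of the same level, that is, of all
cells of that level which meet `C_w`. -/
def D (q : Fin 3 → Plane) (w : List (Fin 3)) : Set Plane :=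
  ⋃ w' ∈ {w' : List (Fin 3) | w'.length = w.length ∧ (cell q w' ∩ cell q w).Nonempty}, cell q w'

/-- `B` is a mean value neighborhood of `x` associated to the cell `C_w`, where `C_w` contains `x` and
does not intersect `V_0`: a (measurable) set with `C_w ⊆ B ⊆ D_w` such that `M_B(h) = h(x)` for every
harmonic function `h`. -/
def IsMeanValueNeighborhoodAt (q : Fin 3 → Plane) (x : Plane) (w : List (Fin 3))
    (B : Set Plane) : Prop :=
  x ∈ cell q w ∧ Disjoint (cell q w) (V q 0 : Set Plane) ∧
    MeasurableSet B ∧ cell q w ⊆ B ∧ B ⊆ D q w ∧ ∀ h, IsHarmonic q h → mean q B h = h x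

/-- `B` is a `k` level mean value neighborhood of `x`: it is one associated to some cell `C_w` with
`w` of length `k`. -/
def IsMeanValueNeighborhood (q : Fin 3 → Plane) (x : Plane) (k : ℕ) (B : Set Plane) : Prop :=
  ∃ w : List (Fin 3), w.length = k ∧ IsMeanValueNeighborhoodAt q x w B

/-! The set `SG` is the attractor of the iterated function system. -/

theorem norm_coding_term_le (q : Fin 3 → Plane) (n : ℕ) (ω : ℕ → Fin 3) :
    ‖(1 / 2 : ℝ) ^ (n + 1) • q (ω n)‖ ≤ (1 / 2 : ℝ) ^ (n + 1) * ∑ i, ‖q i‖ := by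
  rw [norm_smul, Real.norm_of_nonneg (by positivity)]
  gcongr
  exact Finset.single_le_sum (f := fun i => ‖q i‖) (fun i _ => norm_nonneg _) (Finset.mem_univ _)

theorem summable_coding_bound (q : Fin 3 → Plane) :
    Summable fun n : ℕ => (1 / 2 : ℝ) ^ (n + 1) * ∑ i, ‖q i‖ :=
  ((summable_nat_add_iff 1).2 summable_geometric_two).mul_right _

theorem continuous_coding (q : Fin 3 → Plane) : Continuous (coding q) := by
  refine continuous_tsum (fun n => ?_) (summable_coding_bound q) (norm_coding_term_le q)
  have h : Continuous fun ω : ℕ → Fin 3 => q (ω n) :=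
    Continuous.comp (g := q) continuous_of_discreteTopology (continuous_apply n)
  exact h.const_smul ((1 / 2 : ℝ) ^ (n + 1))

theorem coding_cons (q : Fin 3 → Plane) (ω : ℕ → Fin 3) :
    coding q ω = F q (ω 0) (coding q fun n => ω (n + 1)) := by
  have hs : Summable fun n : ℕ => (1 / 2 : ℝ) ^ (n + 1) • q (ω n) :=
    (summable_coding_bound q).of_norm_bounded (fun n => norm_coding_term_le q n ω)
  have h2 : ∑' n : ℕ, (1 / 2 : ℝ) ^ (n + 1 + 1) • q (ω (n + 1)) =
      (1 / 2 : ℝ) • coding q fun n => ω (n + 1) := by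
    rw [coding, ← tsum_const_smul'']
    simp only [smul_smul, pow_succ']
  rw [coding, hs.tsum_eq_zero_add, h2, F]
  module

theorem isCompact_SG (q : Fin 3 → Plane) : IsCompact (SG q) :=
  isCompact_range (continuous_coding q)

theorem SG_nonempty (q : Fin 3 → Plane) : (SG q).Nonempty := Set.range_nonempty _

theorem SG_eq_iUnion (q : Fin 3 → Plane) : SG q = ⋃ i, F q i '' SG q := by
  ext x
  simp only [Set.mem_iUnion, Set.mem_image, SG, Set.mem_range]
  constructor
  · rintro ⟨ω, rfl⟩
    exact ⟨ω 0, _, ⟨_, rfl⟩, (coding_cons q ω).symm⟩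
  · rintro ⟨i, _, ⟨ω, rfl⟩, rfl⟩
    exact ⟨fun n => Nat.casesOn n i ω, coding_cons q _⟩

theorem isProbabilityMeasure_μ (q : Fin 3 → Plane) : IsProbabilityMeasure (μ q) :=
  Measure.isProbabilityMeasure_map (continuous_coding q).measurable.aemeasurable

end SierpinskiGasket

end

/-! Write e = 5^{-k} for a cell C_w of level k. A function has constant Laplacian s exactly when, on
each cell, its value at the midpoint between corners i and j is (2a_i + 2a_j + a_l)/5 minus s' / 15,
where s' is s times 5^{-level} (`Subdivides`). One direction is a discrete Gauss–Green formula for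
the graph energies (`Subdivides.hasLaplacian`). The other tests the weak equation against bumps that
are harmonic on the three subcells of a cell (`HasLaplacian.subdivides`). The rule gives existence
(`exists_subdivides`), the exact integral (`Subdivides.integral_eq`) and a maximum principle with a
lower bound (`Subdivides.bounds`).

Adding a harmonic function to v does not change M_B(v) - v(x). Let x lie in the subcell F_w
F_{i₀}(SG) of C_w. Subtract the harmonic h for which u = v - h is 0 at the corner i₀ of C_w and e/9
at the other two (`exists_harmonic_corner_eq`). The rule then makes u vanish at all three corners of
the subcell of x, so u(x) ≤ 0, while the average of u over C_w is e/54. On the neighboring cell at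
the corner i₀ one has u ≥ -e/60, and on the other neighbors u ≥ 0 (`Subdivides.neighbor_bounds`).
Hence, whatever part of the neighbors B contains, the integral of u - u(x) over B is at least 3^{-k}
e (1/54 - 1/60). Since μ(B) ≤ 4 · 3^{-k}, the lower bound follows. The upper bound only needs u ≤ e
on D_w and u(x) ≥ -e/12. -/

noncomputable section

namespace SierpinskiGasket

/-! ### Index bookkeeping -/

theorem exists_third : ∀ i j : Fin 3, i ≠ j → ∃ l, l ≠ i ∧ l ≠ j := by decide

theorem sum_third {M : Type*} [AddCommMonoid M] {i j l : Fin 3} (hij : i ≠ j) (hli : l ≠ i)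
    (hlj : l ≠ j) (f : Fin 3 → M) : ∑ m, f m = f i + f j + f l := by
  have h : (Finset.univ : Finset (Fin 3)) = {i, j, l} := by
    revert i j l; decide
  rw [h, Finset.sum_insert (by simp [hij, hli.symm]), Finset.sum_insert (by simp [hlj.symm]),
    Finset.sum_singleton, add_assoc]

theorem eq_third {i j l : Fin 3} (hij : i ≠ j) (hli : l ≠ i) (hlj : l ≠ j) (m : Fin 3) :
    m = i ∨ m = j ∨ m = l := by
  revert i j l m; decide

/-! ### Barycentric coordinates -/

/-- The sum of the vectors `q i - q m` is normal to the side opposite `q i`. Its inner product with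
an edge at `q i` is s² + s²/2, which explains the factor 2 / (3 s²). -/
theorem exists_barycentric {q : Fin 3 → Plane} (hq : IsEquilateral q) :
    ∃ (b : Fin 3 → Plane) (a : Fin 3 → ℝ),
      ∀ i j, inner ℝ (b i) (q j) + a i = if i = j then 1 else 0 := by
  obtain ⟨s, hs, h⟩ := hq
  refine ⟨fun i => (2 / (3 * s ^ 2)) • ∑ m, (q i - q m),
    fun i => 1 - inner ℝ ((2 / (3 * s ^ 2)) • ∑ m, (q i - q m)) (q i), fun i j => ?_⟩
  split_ifs with hij
  · subst hij; ring
  · obtain ⟨l, hli, hlj⟩ := exists_third i j hij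
    have key : inner ℝ ((2 / (3 * s ^ 2)) • ∑ m, (q i - q m)) (q i - q j) = (1 : ℝ) := by
      rw [sum_third hij hli hlj, sub_self, zero_add, inner_smul_left, inner_add_left,
        real_inner_self_eq_norm_mul_norm,
        real_inner_eq_norm_mul_self_add_norm_mul_self_sub_norm_sub_mul_self_div_two]
      have e : q i - q l - (q i - q j) = q j - q l := by abel
      rw [e, ← dist_eq_norm, ← dist_eq_norm, ← dist_eq_norm, h i j hij, h i l hli.symm,
        h j l hlj.symm]
      simp only [conj_trivial]
      field_simp
      ring
    rw [inner_sub_right] at key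
    linarith

/-- Barycentric coordinates with respect to the triangle. -/
def bary (q : Fin 3 → Plane) (hq : IsEquilateral q) (i : Fin 3) (x : Plane) : ℝ :=
  inner ℝ ((exists_barycentric hq).choose i) x + (exists_barycentric hq).choose_spec.choose i

section
variable {q : Fin 3 → Plane} (hq : IsEquilateral q)

theorem bary_vertex (i j : Fin 3) : bary q hq i (q j) = if i = j then 1 else 0 :=
  (exists_barycentric hq).choose_spec.choose_spec i j

theorem bary_F (i j : Fin 3) (x : Plane) :
    bary q hq i (F q j x) = (bary q hq i (q j) + bary q hq i x) / 2 := by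
  simp only [bary, F, inner_add_right, inner_smul_right, inner_sub_right]
  ring

theorem continuous_bary (i : Fin 3) : Continuous (bary q hq i) := by
  unfold bary
  fun_prop

end

/-! ### The contractions and the cells -/

section
variable (q : Fin 3 → Plane)

theorem continuous_F (i : Fin 3) : Continuous (F q i) := by
  unfold F
  fun_prop

theorem F_injective (i : Fin 3) : Function.Injective (F q i) := by
  intro x y h
  have h2 : (1 / 2 : ℝ) • (x - q i) = (1 / 2 : ℝ) • (y - q i) := add_left_cancel h
  have h3 := smul_right_injective Plane (by norm_num : (1 / 2 : ℝ) ≠ 0) h2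
  exact sub_left_injective h3

@[simp] theorem F_self (i : Fin 3) : F q i (q i) = q i := by simp [F]

theorem F_comm (i j : Fin 3) : F q i (q j) = F q j (q i) := by
  simp only [F]
  module

theorem F_leftInverse (i : Fin 3) (x : Plane) : (2 : ℝ) • F q i x - q i = x := by
  simp only [F]
  module

theorem dist_F (i : Fin 3) (x y : Plane) : dist (F q i x) (F q i y) = dist x y / 2 := by
  have e : F q i x - F q i y = (1 / 2 : ℝ) • (x - y) := by
    simp only [F]
    module
  rw [dist_eq_norm, e, norm_smul, dist_eq_norm]
  norm_num
  ring

@[simp] theorem Fword_nil (x : Plane) : Fword q [] x = x := rfl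

@[simp] theorem Fword_cons (i : Fin 3) (w : List (Fin 3)) (x : Plane) :
    Fword q (i :: w) x = F q i (Fword q w x) := rfl

theorem Fword_append (w w' : List (Fin 3)) (x : Plane) :
    Fword q (w ++ w') x = Fword q w (Fword q w' x) := by
  induction w with
  | nil => rfl
  | cons i w ih => simp [ih]

theorem Fword_injective (w : List (Fin 3)) : Function.Injective (Fword q w) := by
  induction w with
  | nil => exact Function.injective_id
  | cons i w ih => exact (F_injective q i).comp ih

theorem continuous_Fword (w : List (Fin 3)) : Continuous (Fword q w) := by
  induction w with
  | nil => exact continuous_id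
  | cons i w ih => exact (continuous_F q i).comp ih

theorem dist_Fword (w : List (Fin 3)) (x y : Plane) :
    dist (Fword q w x) (Fword q w y) = (1 / 2) ^ w.length * dist x y := by
  induction w with
  | nil => simp
  | cons i w ih =>
    rw [Fword_cons, Fword_cons, dist_F, ih, List.length_cons]
    ring

theorem Fword_replicate (i : Fin 3) (n : ℕ) : Fword q (List.replicate n i) (q i) = q i := by
  induction n with
  | zero => rfl
  | succ n ih => simp [List.replicate_succ, ih]

variable {q}

theorem F_mem_SG {x : Plane} (hx : x ∈ SG q) (i : Fin 3) : F q i x ∈ SG q := by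
  rw [SG_eq_iUnion]
  exact Set.mem_iUnion.2 ⟨i, x, hx, rfl⟩

theorem exists_F_eq {x : Plane} (hx : x ∈ SG q) : ∃ i, ∃ y ∈ SG q, F q i y = x := by
  rw [SG_eq_iUnion] at hx
  exact Set.mem_iUnion.1 hx

theorem Fword_mem_SG {x : Plane} (hx : x ∈ SG q) (w : List (Fin 3)) : Fword q w x ∈ SG q := by
  induction w with
  | nil => exact hx
  | cons i w ih => exact F_mem_SG ih i

theorem coding_const (i : Fin 3) : coding q (fun _ => i) = q i := by
  have h := F_leftInverse q i (coding q fun _ => i)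
  rw [← coding_cons q fun _ => i] at h
  have h0 : coding q (fun _ => i) - q i =
      (2 : ℝ) • coding q (fun _ => i) - q i - coding q (fun _ => i) := by module
  rw [h, sub_self] at h0
  exact sub_eq_zero.1 h0

theorem vertex_mem_SG (i : Fin 3) : q i ∈ SG q := ⟨_, coding_const i⟩

theorem Fword_vertex_mem_SG (w : List (Fin 3)) (i : Fin 3) : Fword q w (q i) ∈ SG q :=
  Fword_mem_SG (vertex_mem_SG i) w

end

/-! ### Separating points and cells by barycentric coordinates -/

section
variable {q : Fin 3 → Plane}

/-- Maximum principle from self-similarity: at a maximum point `F q j y` the value is the mean of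
the value at `y` and of 0 or 1, so the maximum is at most 1. The lower bound is dual. -/
theorem bary_le_one (hq : IsEquilateral q) (i : Fin 3) {x : Plane} (hx : x ∈ SG q) :
    bary q hq i x ≤ 1 := by
  obtain ⟨z, hz, hmax⟩ :=
    (isCompact_SG q).exists_isMaxOn (SG_nonempty q) (continuous_bary hq i).continuousOn
  obtain ⟨j, y, hy, rfl⟩ := exists_F_eq hz
  have h1 := isMaxOn_iff.1 hmax y hy
  have h2 := isMaxOn_iff.1 hmax x hx
  rw [bary_F, bary_vertex] at h1 h2
  split_ifs at h1 h2 <;> linarith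

theorem bary_nonneg (hq : IsEquilateral q) (i : Fin 3) {x : Plane} (hx : x ∈ SG q) :
    0 ≤ bary q hq i x := by
  obtain ⟨z, hz, hmin⟩ :=
    (isCompact_SG q).exists_isMinOn (SG_nonempty q) (continuous_bary hq i).continuousOn
  obtain ⟨j, y, hy, rfl⟩ := exists_F_eq hz
  have h1 := isMinOn_iff.1 hmin y hy
  have h2 := isMinOn_iff.1 hmin x hx
  rw [bary_F, bary_vertex] at h1 h2
  split_ifs at h1 h2 <;> linarith

theorem bary_F_eq_one (hq : IsEquilateral q) {i j : Fin 3} {y : Plane} (hy : y ∈ SG q)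
    (h : bary q hq i (F q j y) = 1) : i = j ∧ bary q hq i y = 1 := by
  have h1 := bary_le_one hq i hy
  rw [bary_F, bary_vertex] at h
  split_ifs at h with hij
  · exact ⟨hij, by linarith⟩
  · linarith

/-- The points with coordinate 1 form a compact set, each of whose points is `F q i y` with `y` in
the set and twice as far from `q i`. The largest distance is therefore 0. -/
theorem eq_vertex_of_bary_eq_one (hq : IsEquilateral q) {i : Fin 3} {x : Plane} (hx : x ∈ SG q)
    (h : bary q hq i x = 1) : x = q i := by
  have hc : IsCompact (SG q ∩ bary q hq i ⁻¹' {1}) :=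
    (isCompact_SG q).inter_right (isClosed_singleton.preimage (continuous_bary hq i))
  obtain ⟨z, ⟨hz, hz1⟩, hmax⟩ := hc.exists_isMaxOn ⟨x, hx, h⟩
    (continuous_id.dist (continuous_const (y := q i))).continuousOn
  obtain ⟨j, y, hy, rfl⟩ := exists_F_eq hz
  obtain ⟨rfl, hy1⟩ := bary_F_eq_one hq hy hz1
  have h1 := isMaxOn_iff.1 hmax y ⟨hy, hy1⟩
  have h2 := isMaxOn_iff.1 hmax x ⟨hx, h⟩
  have h3 : dist (F q i y) (q i) = dist y (q i) / 2 := by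
    conv_lhs => rw [← F_self q i]
    exact dist_F q i y (q i)
  simp only [id] at h1 h2
  rw [h3] at h1 h2
  have h4 : dist x (q i) ≤ 0 := by linarith [dist_nonneg (x := y) (y := q i)]
  exact dist_le_zero.1 h4

theorem vertex_injective (hq : IsEquilateral q) : Function.Injective q := by
  intro i j h
  have h1 := bary_vertex hq i j
  rw [← h, bary_vertex hq i i] at h1
  by_contra hne
  simp [hne] at h1

theorem F_eq_vertex (hq : IsEquilateral q) {i j : Fin 3} {y : Plane} (hy : y ∈ SG q)
    (h : F q j y = q i) : i = j ∧ y = q i := by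
  obtain ⟨h1, h2⟩ := bary_F_eq_one hq (i := i) (j := j) hy (by rw [h, bary_vertex, if_pos rfl])
  exact ⟨h1, eq_vertex_of_bary_eq_one hq hy h2⟩

/-- The `j`-th coordinate is at most 1/2 on `F_i(SG)` and at least 1/2 on `F_j(SG)`. Equality is
attained only at the common corner. -/
theorem F_eq_F (hq : IsEquilateral q) {i j : Fin 3} (hij : i ≠ j) {x y : Plane} (hx : x ∈ SG q)
    (hy : y ∈ SG q) (h : F q i x = F q j y) : x = q j ∧ y = q i := by
  have hbj := congrArg (bary q hq j) h
  have hbi := congrArg (bary q hq i) h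
  rw [bary_F, bary_F, bary_vertex, bary_vertex] at hbi hbj
  simp only [hij, hij.symm, if_true, if_false] at hbi hbj
  refine ⟨eq_vertex_of_bary_eq_one hq hx ?_, eq_vertex_of_bary_eq_one hq hy ?_⟩
  · linarith [bary_le_one hq j hx, bary_nonneg hq j hy]
  · linarith [bary_le_one hq i hy, bary_nonneg hq i hx]

theorem Fword_eq_vertex (hq : IsEquilateral q) {w : List (Fin 3)} {i : Fin 3} {y : Plane}
    (hy : y ∈ SG q) (h : Fword q w y = q i) : w = List.replicate w.length i ∧ y = q i := by
  induction w with
  | nil => exact ⟨rfl, h⟩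
  | cons j w ih =>
    obtain ⟨rfl, h2⟩ := F_eq_vertex hq (Fword_mem_SG hy w) h
    obtain ⟨h3, h4⟩ := ih h2
    refine ⟨?_, h4⟩
    rw [List.length_cons, List.replicate_succ, ← h3]

/-- Two distinct cells of the same level meet at most in one point, which is a corner of both. -/
theorem Fword_eq_Fword (hq : IsEquilateral q) {w w' : List (Fin 3)} (hl : w.length = w'.length)
    (hne : w ≠ w') {y y' : Plane} (hy : y ∈ SG q) (hy' : y' ∈ SG q)
    (h : Fword q w y = Fword q w' y') :
    ∃ (τ : List (Fin 3)) (i j : Fin 3) (n : ℕ), i ≠ j ∧ w = τ ++ i :: List.replicate n j ∧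
      w' = τ ++ j :: List.replicate n i ∧ y = q j ∧ y' = q i := by
  induction w generalizing w' with
  | nil =>
    rw [List.length_nil] at hl
    exact absurd (List.length_eq_zero_iff.1 hl.symm).symm hne
  | cons a w ih =>
    cases w' with
    | nil => simp at hl
    | cons a' w' =>
      have hl' : w.length = w'.length := by simpa using hl
      by_cases haa : a = a'
      · subst haa
        obtain ⟨τ, i, j, n, hij, h1, h2, h3, h4⟩ :=
          ih hl' (fun e => hne (by rw [e])) (F_injective q a h)
        exact ⟨a :: τ, i, j, n, hij, by rw [h1]; rfl, by rw [h2]; rfl, h3, h4⟩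
      · obtain ⟨h1, h2⟩ := F_eq_F hq haa (Fword_mem_SG hy w) (Fword_mem_SG hy' w') h
        obtain ⟨h3, h4⟩ := Fword_eq_vertex hq hy h1
        obtain ⟨h5, h6⟩ := Fword_eq_vertex hq hy' h2
        refine ⟨[], a, a', w.length, haa, ?_, ?_, h4, h6⟩
        · rw [List.nil_append, ← h3]
        · rw [List.nil_append, hl', ← h5]

/-- Read from the right, `n` is the length of the final run of `j` and `i` is the letter that ends
it. -/
theorem append_cons_replicate_inj {α : Type*} {τ τ' : List α} {i i' j : α} {n n' : ℕ} (hij : i ≠ j)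
    (hij' : i' ≠ j)
    (h : τ ++ i :: List.replicate n j = τ' ++ i' :: List.replicate n' j) :
    τ = τ' ∧ i = i' ∧ n = n' := by
  have h' := congrArg List.reverse h
  simp only [List.reverse_append, List.reverse_cons, List.reverse_replicate, List.append_assoc,
    List.cons_append, List.nil_append] at h'
  have key : ∀ (n n' : ℕ) (σ σ' : List α),
      List.replicate n j ++ i :: σ = List.replicate n' j ++ i' :: σ' → σ = σ' ∧ i = i' ∧ n = n' := by
    intro n
    induction n with
    | zero =>
      intro n' σ σ' e
      cases n' with
      | zero => simpa [and_comm] using e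
      | succ n' =>
        simp only [List.replicate_zero, List.nil_append, List.replicate_succ, List.cons_append,
          List.cons.injEq] at e
        exact absurd e.1 hij
    | succ n ih =>
      intro n' σ σ' e
      cases n' with
      | zero =>
        simp only [List.replicate_zero, List.nil_append, List.replicate_succ, List.cons_append,
          List.cons.injEq] at e
        exact absurd e.1.symm hij'
      | succ n' =>
        simp only [List.replicate_succ, List.cons_append, List.cons.injEq, true_and] at e
        obtain ⟨h1, h2, h3⟩ := ih n' σ σ' e
        exact ⟨h1, h2, by rw [h3]⟩
  obtain ⟨h1, h2, h3⟩ := key n n' _ _ h'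
  exact ⟨List.reverse_injective h1, h2, h3⟩

/-- The two words first differ at the letters `i` and `j`, so the pair of words determines both.
Consequently two distinct cells of one level share a single point, and no edge lies in both. -/
theorem append_cons_replicate_pair_inj {α : Type*} {τ τ' : List α} {i j i' j' : α} {n n' : ℕ}
    (hij : i ≠ j) (hij' : i' ≠ j')
    (h : τ ++ i :: List.replicate n j = τ' ++ i' :: List.replicate n' j')
    (h' : τ ++ j :: List.replicate n i = τ' ++ j' :: List.replicate n' i') : i = i' ∧ j = j' := by
  induction τ generalizing τ' with
  | nil =>
    cases τ' with
    | nil => exact ⟨(List.cons.inj h).1, (List.cons.inj h').1⟩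
    | cons a τ' => exact absurd ((List.cons.inj h).1.trans (List.cons.inj h').1.symm) hij
  | cons a τ ih =>
    cases τ' with
    | nil => exact absurd ((List.cons.inj h).1.symm.trans (List.cons.inj h').1) hij'
    | cons a' τ' => exact ih (List.cons.inj h).2 (List.cons.inj h').2

/-- `w'` is the word of the cell, other than `C_w`, that contains the corner `F_w (q j)` of `C_w`. -/
def IsNeighbor (w : List (Fin 3)) (j : Fin 3) (w' : List (Fin 3)) : Prop :=
  ∃ (τ : List (Fin 3)) (i : Fin 3) (n : ℕ), i ≠ j ∧ w = τ ++ i :: List.replicate n j ∧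
    w' = τ ++ j :: List.replicate n i

theorem IsNeighbor.unique {w w' w'' : List (Fin 3)} {j : Fin 3} (h' : IsNeighbor w j w')
    (h'' : IsNeighbor w j w'') : w' = w'' := by
  obtain ⟨τ, i, n, hij, rfl, rfl⟩ := h'
  obtain ⟨τ', i', n', hij', h, rfl⟩ := h''
  obtain ⟨rfl, rfl, rfl⟩ := append_cons_replicate_inj hij hij' h
  rfl

theorem exists_isNeighbor (hq : IsEquilateral q) {w w' : List (Fin 3)}
    (hl : w.length = w'.length) (hne : w ≠ w') {y y' : Plane} (hy : y ∈ SG q) (hy' : y' ∈ SG q)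
    (h : Fword q w y = Fword q w' y') :
    ∃ j, IsNeighbor w j w' ∧ y = q j ∧ ∃ i, y' = q i := by
  obtain ⟨τ, i, j, n, hij, h1, h2, h3, h4⟩ := Fword_eq_Fword hq hl hne hy hy' h
  exact ⟨j, ⟨τ, i, n, hij, h1, h2⟩, h3, i, h4⟩

/-! ### Gluing functions on the three cells of level one -/

open Classical in
/-- The function which is `g i ∘ (F_i)⁻¹` on `F_i(SG)`. -/
def glue (q : Fin 3 → Plane) (g : Fin 3 → Plane → ℝ) (x : Plane) : ℝ :=
  if h : ∃ p : Fin 3 × Plane, p.2 ∈ SG q ∧ F q p.1 p.2 = x then g h.choose.1 h.choose.2 else 0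

/-- A point with two preimages is `F q i (q j) = F q j (q i)`, where `hg` makes the choice
immaterial. -/
theorem glue_F (hq : IsEquilateral q) {g : Fin 3 → Plane → ℝ}
    (hg : ∀ i j, i ≠ j → g i (q j) = g j (q i)) (i : Fin 3) {y : Plane} (hy : y ∈ SG q) :
    glue q g (F q i y) = g i y := by
  have h : ∃ p : Fin 3 × Plane, p.2 ∈ SG q ∧ F q p.1 p.2 = F q i y := ⟨(i, y), hy, rfl⟩
  rw [glue, dif_pos h]
  obtain ⟨h1, h2⟩ := h.choose_spec
  by_cases hi : h.choose.1 = i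
  · rw [hi] at h2 ⊢
    rw [F_injective q i h2]
  · obtain ⟨h3, h4⟩ := F_eq_F hq hi h1 hy h2
    rw [h3]
    exact (hg _ _ hi).trans (congrArg (g i) h4.symm)

theorem continuousOn_glue (hq : IsEquilateral q) {g : Fin 3 → Plane → ℝ}
    (hg : ∀ i j, i ≠ j → g i (q j) = g j (q i)) (hc : ∀ i, ContinuousOn (g i) (SG q)) :
    ContinuousOn (glue q g) (SG q) := by
  rw [SG_eq_iUnion]
  refine (locallyFinite_of_finite _).continuousOn_iUnion
    (fun i => ((isCompact_SG q).image (continuous_F q i)).isClosed) fun i => ?_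
  have h1 : ContinuousOn (fun x => g i ((2 : ℝ) • x - q i)) (F q i '' SG q) := by
    refine (hc i).comp (by fun_prop) ?_
    rintro _ ⟨y, hy, rfl⟩
    simpa only [F_leftInverse] using hy
  refine h1.congr ?_
  rintro _ ⟨y, hy, rfl⟩
  simp only
  rw [glue_F hq hg i hy, F_leftInverse]

end

/-! ### Words -/

/-- Prepending a letter to a word. -/
def consEmbedding : Fin 3 × List (Fin 3) ↪ List (Fin 3) where
  toFun p := p.1 :: p.2
  inj' _ _ h := Prod.ext (List.cons.inj h).1 (List.cons.inj h).2

theorem consEmbedding_apply (p : Fin 3 × List (Fin 3)) : consEmbedding p = p.1 :: p.2 := rfl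

/-- The words of length `m`. -/
def words : ℕ → Finset (List (Fin 3))
  | 0 => {[]}
  | m + 1 => ((Finset.univ : Finset (Fin 3)) ×ˢ words m).map consEmbedding

theorem mem_words {m : ℕ} {w : List (Fin 3)} : w ∈ words m ↔ w.length = m := by
  induction m generalizing w with
  | zero => simp [words]
  | succ m ih =>
    simp only [words, Finset.mem_map, Finset.mem_product, Finset.mem_univ, true_and, ih,
      consEmbedding_apply, Prod.exists]
    constructor
    · rintro ⟨i, w, h, rfl⟩
      simp [h]
    · intro h
      cases w with
      | nil => simp at h
      | cons i w => exact ⟨i, w, by simpa using h, rfl⟩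

theorem sum_words_succ {M : Type*} [AddCommMonoid M] (m : ℕ) (f : List (Fin 3) → M) :
    ∑ w ∈ words (m + 1), f w = ∑ i, ∑ w ∈ words m, f (i :: w) := by
  simp [words, Finset.sum_product, consEmbedding_apply]

theorem sum_words_zero {M : Type*} [AddCommMonoid M] (f : List (Fin 3) → M) :
    ∑ w ∈ words 0, f w = f [] := by
  simp [words]

theorem card_words (m : ℕ) : (words m).card = 3 ^ m := by
  induction m with
  | zero => rfl
  | succ m ih => simp [words, ih, pow_succ']

/-! ### Self-similarity of the measure -/

/-- Prepending an independent letter to an i.i.d. sequence gives an i.i.d. sequence. Through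
`coding_cons` this becomes the self-similarity of `μ`. -/
theorem map_cons_infinitePi {α : Type*} [MeasurableSpace α] (ν : Measure α)
    [IsProbabilityMeasure ν] :
    (ν.prod (Measure.infinitePi fun _ : ℕ => ν)).map
      (fun p n => Nat.casesOn n p.1 p.2 : α × (ℕ → α) → ℕ → α) =
      Measure.infinitePi fun _ : ℕ => ν := by
  classical
  have hm : Measurable (fun p n => Nat.casesOn n p.1 p.2 : α × (ℕ → α) → ℕ → α) := by
    refine measurable_pi_lambda _ fun n => ?_
    cases n with
    | zero => exact measurable_fst
    | succ n => exact (measurable_pi_apply n).comp measurable_snd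
  refine Measure.eq_infinitePi _ fun s t ht => ?_
  obtain ⟨N, hN⟩ := s.exists_nat_subset_range
  -- Padding by `Set.univ` turns the cylinder over `s` into one over an initial segment, which
  -- splits into its coordinate 0 and a shifted cylinder.
  set t' : ℕ → Set α := fun i => if i ∈ s then t i else Set.univ with ht'
  have hmt' : ∀ i, MeasurableSet (t' i) := fun i => by
    simp only [ht']
    split_ifs
    exacts [ht i, MeasurableSet.univ]
  have hpre : (fun p n => Nat.casesOn n p.1 p.2 : α × (ℕ → α) → ℕ → α) ⁻¹' Set.pi s t =
      t' 0 ×ˢ Set.pi (Finset.range N) fun n => t' (n + 1) := by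
    ext ⟨a, ω⟩
    simp only [Set.mem_preimage, Set.mem_pi, Finset.mem_coe, Set.mem_prod, Finset.mem_range, ht']
    constructor
    · intro h
      constructor
      · split_ifs with h0
        exacts [h 0 h0, trivial]
      · intro n _
        split_ifs with h0
        exacts [h (n + 1) h0, trivial]
    · rintro ⟨h0, h1⟩ n hn
      cases n with
      | zero => simpa [hn] using h0
      | succ n =>
        have := h1 n (by have := Finset.mem_range.1 (hN hn); omega)
        simpa [hn] using this
  rw [Measure.map_apply hm (MeasurableSet.pi s.countable_toSet fun i _ => ht i), hpre,
    Measure.prod_prod, Measure.infinitePi_pi _ fun i _ => hmt' (i + 1), mul_comm,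
    ← Finset.prod_range_succ' (fun i => ν (t' i))]
  have hsub : s ⊆ Finset.range (N + 1) := hN.trans (Finset.range_mono (Nat.le_succ N))
  rw [← Finset.prod_subset hsub]
  · refine Finset.prod_congr rfl fun i hi => ?_
    simp [ht', hi]
  · intro i _ hi
    simp [ht', hi]

section
variable (q : Fin 3 → Plane)

instance : IsProbabilityMeasure (μ q) := isProbabilityMeasure_μ q

/-- The uniform distribution on the three letters. -/
def letterMeasure : Measure (Fin 3) := (PMF.uniformOfFintype (Fin 3)).toMeasure

instance : IsProbabilityMeasure letterMeasure := by
  unfold letterMeasure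
  infer_instance

theorem letterMeasure_singleton (i : Fin 3) : letterMeasure {i} = 3⁻¹ := by
  rw [letterMeasure, PMF.toMeasure_apply_singleton _ _ (MeasurableSet.singleton i)]
  simp [PMF.uniformOfFintype_apply]

theorem measurable_F_uncurry : Measurable fun p : Fin 3 × Plane => F q p.1 p.2 :=
  measurable_from_prod_countable_right fun i => (continuous_F q i).measurable

theorem map_F_μ : (letterMeasure.prod (μ q)).map (fun p => F q p.1 p.2) = μ q := by
  have hμ : μ q = (Measure.infinitePi fun _ : ℕ => letterMeasure).map (coding q) := rfl
  have hc := (continuous_coding q).measurable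
  have h1 : letterMeasure.prod (μ q) =
      (letterMeasure.prod (Measure.infinitePi fun _ : ℕ => letterMeasure)).map
        (Prod.map id (coding q)) := by
    rw [← Measure.map_prod_map _ _ measurable_id hc, Measure.map_id, hμ]
  rw [h1, Measure.map_map (measurable_F_uncurry q) (measurable_id.prodMap hc)]
  conv_rhs => rw [hμ, ← map_cons_infinitePi letterMeasure]
  have hm : Measurable
      (fun p n => Nat.casesOn n p.1 p.2 : Fin 3 × (ℕ → Fin 3) → ℕ → Fin 3) := by
    refine measurable_pi_lambda _ fun n => ?_
    cases n with
    | zero => exact measurable_fst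
    | succ n => exact (measurable_pi_apply n).comp measurable_snd
  rw [Measure.map_map hc hm]
  congr 1
  funext p
  exact (coding_cons q fun n => Nat.casesOn n p.1 p.2).symm

variable {q}

theorem integrable_comp_F {f : Plane → ℝ} (hf : Integrable f (μ q)) (i : Fin 3) :
    Integrable (fun x => f (F q i x)) (μ q) := by
  rw [← map_F_μ q] at hf
  have h := (integrable_map_measure hf.aestronglyMeasurable
    (measurable_F_uncurry q).aemeasurable).1 hf
  refine (ae_iff_of_countable.1 h.prod_right_ae) i ?_
  simp [letterMeasure_singleton]

theorem integral_μ_eq {f : Plane → ℝ} (hf : Integrable f (μ q)) :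
    ∫ x, f x ∂(μ q) = (1 / 3) * ∑ i, ∫ x, f (F q i x) ∂(μ q) := by
  have hf' := hf
  rw [← map_F_μ q] at hf'
  have h := (integrable_map_measure hf'.aestronglyMeasurable
    (measurable_F_uncurry q).aemeasurable).1 hf'
  conv_lhs => rw [← map_F_μ q]
  rw [integral_map (measurable_F_uncurry q).aemeasurable hf'.aestronglyMeasurable,
    integral_prod (fun p : Fin 3 × Plane => f (F q p.1 p.2)) h,
    integral_fintype (Integrable.of_finite), Finset.mul_sum]
  refine Finset.sum_congr rfl fun i _ => ?_
  simp [measureReal_def, letterMeasure_singleton]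

theorem integrable_comp_Fword {f : Plane → ℝ} (hf : Integrable f (μ q)) (w : List (Fin 3)) :
    Integrable (fun x => f (Fword q w x)) (μ q) := by
  induction w generalizing f with
  | nil => exact hf
  | cons i w ih => exact ih (integrable_comp_F hf i)

theorem integral_μ_eq_sum_words {f : Plane → ℝ} (hf : Integrable f (μ q)) (m : ℕ) :
    ∫ x, f x ∂(μ q) = (1 / 3) ^ m * ∑ w ∈ words m, ∫ x, f (Fword q w x) ∂(μ q) := by
  induction m generalizing f with
  | zero => simp [sum_words_zero]
  | succ m ih =>
    have h : ∀ i, ∫ x, f (F q i x) ∂(μ q) =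
        (1 / 3) ^ m * ∑ w ∈ words m, ∫ x, f (Fword q (i :: w) x) ∂(μ q) :=
      fun i => ih (integrable_comp_F hf i)
    rw [integral_μ_eq hf, sum_words_succ, pow_succ', mul_assoc,
      Finset.sum_congr rfl fun i _ => h i, ← Finset.mul_sum]

variable (q) in
theorem ae_mem_SG : ∀ᵐ x ∂(μ q), x ∈ SG q := by
  have h : ∀ᵐ x ∂((Measure.infinitePi fun _ : ℕ => letterMeasure).map (coding q)), x ∈ SG q := by
    refine (ae_map_iff (p := fun x => x ∈ SG q) (continuous_coding q).measurable.aemeasurable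
      (isCompact_SG q).measurableSet).2 ?_
    exact Filter.Eventually.of_forall fun ω => ⟨ω, rfl⟩
  exact h

theorem integrable_of_continuousOn {f : Plane → ℝ} (hf : ContinuousOn f (SG q)) :
    Integrable f (μ q) := by
  have h := hf.integrableOn_compact (μ := μ q) (isCompact_SG q)
  rwa [IntegrableOn, Measure.restrict_eq_self_of_ae_mem (ae_mem_SG q)] at h

/-- Only `F_i` hits `q i`, so self-similarity gives mass = mass / 3. Hence overlaps of cells of one
level are null. -/
theorem μ_vertex (hq : IsEquilateral q) (i : Fin 3) : μ q {q i} = 0 := by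
  have h : (∫ x, ({q i} : Set Plane).indicator (fun _ => (1 : ℝ)) x ∂(μ q)) =
      (1 / 3) * ∫ x, ({q i} : Set Plane).indicator (fun _ => (1 : ℝ)) x ∂(μ q) := by
    conv_lhs => rw [integral_μ_eq ((integrable_const 1).indicator (MeasurableSet.singleton _))]
    rw [Finset.sum_eq_single i]
    · congr 1
      refine integral_congr_ae ?_
      filter_upwards [ae_mem_SG q] with x hx
      have : F q i x = q i ↔ x = q i :=
        ⟨fun h => (F_eq_vertex hq hx h).2, fun h => by rw [h, F_self]⟩
      simp [Set.indicator_apply, this]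
    · intro j _ hj
      refine integral_eq_zero_of_ae ?_
      filter_upwards [ae_mem_SG q] with x hx
      have : F q j x ≠ q i := fun h => hj (F_eq_vertex hq hx h).1.symm
      simp [this]
    · simp
  rw [integral_indicator_const _ (MeasurableSet.singleton _), smul_eq_mul, mul_one] at h
  have h2 : (μ q).real {q i} = 0 := by linarith
  exact (measureReal_eq_zero_iff).1 h2

theorem ae_ne_vertex (hq : IsEquilateral q) : ∀ᵐ x ∂(μ q), ∀ i, x ≠ q i := by
  rw [ae_all_iff]
  intro i
  exact measure_eq_zero_iff_ae_notMem.1 (μ_vertex hq i)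

end

/-! ### Subdivision rules -/

/-- The values at the vertices of the subcell `F_i(SG)` of the function `u` with `Δ u = s` and boundary
values `a`. -/
def subdiv (s : ℝ) (i : Fin 3) (a : Fin 3 → ℝ) (j : Fin 3) : ℝ :=
  if i = j then a i else (a i + a j + ∑ l, a l) / 5 - s / 15

theorem subdiv_comm (s : ℝ) (i j : Fin 3) (a : Fin 3 → ℝ) : subdiv s i a j = subdiv s j a i := by
  unfold subdiv
  by_cases h : i = j
  · subst h; rfl
  · rw [if_neg h, if_neg (Ne.symm h)]; ring

theorem sum_subdiv (s : ℝ) (i : Fin 3) (a : Fin 3 → ℝ) :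
    ∑ j, subdiv s i a j = (6 * a i + 3 * ∑ l, a l) / 5 - 2 * s / 15 := by
  obtain ⟨j, hij⟩ := exists_ne i
  obtain ⟨l, hli, hlj⟩ := exists_third i j hij.symm
  simp only [sum_third hij.symm hli hlj, subdiv, if_true, if_neg hij.symm, if_neg hli.symm]
  ring

/-- `u` obeys, on all cells, the subdivision rule of the functions with constant Laplacian `s`. -/
def Subdivides (q : Fin 3 → Plane) (s : ℝ) (u : Plane → ℝ) : Prop :=
  ∀ (w : List (Fin 3)) (i j : Fin 3),
    u (Fword q w (F q i (q j))) = subdiv (s * (1 / 5) ^ w.length) i (fun l => u (Fword q w (q l))) j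

section
variable {q : Fin 3 → Plane} {s : ℝ} {u : Plane → ℝ}

theorem Subdivides.root (h : Subdivides q s u) (i j : Fin 3) :
    u (F q i (q j)) = subdiv s i (fun l => u (q l)) j := by
  simpa using h [] i j

theorem Subdivides.comp_F (h : Subdivides q s u) (i : Fin 3) :
    Subdivides q (s / 5) (fun x => u (F q i x)) := by
  intro w j l
  have := h (i :: w) j l
  rw [List.length_cons, pow_succ', ← mul_assoc] at this
  rw [div_eq_mul_one_div]
  exact this

theorem Subdivides.comp_Fword (h : Subdivides q s u) (w : List (Fin 3)) :
    Subdivides q (s * (1 / 5) ^ w.length) (fun x => u (Fword q w x)) := by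
  intro w' j l
  have := h (w ++ w') j l
  simp only [Fword_append, List.length_append, pow_add, ← mul_assoc] at this
  exact this

theorem Subdivides.sub {v : Plane → ℝ} {t : ℝ} (h : Subdivides q s u) (h' : Subdivides q t v) :
    Subdivides q (s - t) (fun x => u x - v x) := by
  intro w i j
  simp only
  rw [h w i j, h' w i j]
  unfold subdiv
  split_ifs
  · rfl
  · rw [Finset.sum_sub_distrib]; ring

theorem continuousOn_comp_F (hu : ContinuousOn u (SG q)) (i : Fin 3) :
    ContinuousOn (fun x => u (F q i x)) (SG q) :=
  hu.comp (continuous_F q i).continuousOn fun _ hx => F_mem_SG hx i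

theorem continuousOn_comp_Fword (hu : ContinuousOn u (SG q)) (w : List (Fin 3)) :
    ContinuousOn (fun x => u (Fword q w x)) (SG q) :=
  hu.comp (continuous_Fword q w).continuousOn fun _ hx => Fword_mem_SG hx w

/-! ### Oscillation of the corner values -/

/-- The bound for corner values that contracts under subdivision. -/
def OscBound (s D : ℝ) (a : Fin 3 → ℝ) : Prop := ∀ i j, a i - a j + |s| / 6 ≤ D

/-- The worst pair is a corner and a midpoint, where the difference is at most 3/5 of the old
oscillation plus |s|/15. The weight κ = 1/6 of |s| is the solution of 1/15 + κ/5 = 3κ/5. -/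
theorem OscBound.subdiv {D : ℝ} {a : Fin 3 → ℝ} (h : OscBound s D a) (i : Fin 3) :
    OscBound (s / 5) (3 / 5 * D) (subdiv s i a) := by
  intro j l
  have hs : |s / 5| = |s| / 5 := by rw [abs_div]; norm_num
  have h1 := le_abs_self s
  have h2 := neg_abs_le s
  have h3 := abs_nonneg s
  have hD : 0 ≤ D := by linarith [h 0 0]
  rw [hs]
  unfold SierpinskiGasket.subdiv
  by_cases hij : i = j
  · by_cases hil : i = l
    · rw [if_pos hij, if_pos hil]
      linarith [h 0 0]
    · obtain ⟨m, hmi, hml⟩ := exists_third i l hil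
      rw [if_pos hij, if_neg hil, sum_third hil hmi hml]
      linarith [h i l, h i m]
  · by_cases hil : i = l
    · obtain ⟨m, hmi, hmj⟩ := exists_third i j hij
      rw [if_neg hij, if_pos hil, sum_third hij hmi hmj]
      linarith [h j i, h m i]
    · rw [if_neg hij, if_neg hil]
      linarith [h j l, h 0 0]

theorem OscBound.abs_subdiv_sub_le {D : ℝ} {a : Fin 3 → ℝ} (h : OscBound s D a) (i j l : Fin 3) :
    |SierpinskiGasket.subdiv s i a j - a l| ≤ D := by
  have h1 := le_abs_self s
  have h2 := neg_abs_le s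
  have h3 := abs_nonneg s
  unfold SierpinskiGasket.subdiv
  rw [abs_le]
  split_ifs with hij
  · constructor <;> linarith [h i l, h l i]
  · obtain ⟨m, hmi, hmj⟩ := exists_third i j hij
    rw [sum_third hij hmi hmj]
    constructor <;> linarith [h i l, h l i, h j l, h l j, h m l, h l m]

theorem exists_oscBound (s : ℝ) (a : Fin 3 → ℝ) : ∃ D, OscBound s D a := by
  refine ⟨(∑ i, ∑ j, |a i - a j|) + |s| / 6, fun i j => ?_⟩
  have h1 : |a i - a j| ≤ ∑ j, |a i - a j| :=
    Finset.single_le_sum (f := fun j => |a i - a j|) (fun _ _ => abs_nonneg _) (Finset.mem_univ j)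
  have h2 : ∑ j, |a i - a j| ≤ ∑ i, ∑ j, |a i - a j| :=
    Finset.single_le_sum (f := fun i => ∑ j, |a i - a j|)
      (fun _ _ => Finset.sum_nonneg fun _ _ => abs_nonneg _) (Finset.mem_univ i)
  linarith [le_abs_self (a i - a j)]

/-! ### Existence of functions with constant Laplacian and given boundary values -/

/-- The approximations to the function with constant Laplacian `s` and boundary values `a`. -/
def approx (q : Fin 3 → Plane) (hq : IsEquilateral q) : ℕ → ℝ → (Fin 3 → ℝ) → Plane → ℝ
  | 0, _, a => fun x => ∑ i, a i * bary q hq i x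
  | n + 1, s, a => glue q fun i => approx q hq n (s / 5) (subdiv s i a)

theorem approx_vertex (hq : IsEquilateral q) (n : ℕ) (s : ℝ) (a : Fin 3 → ℝ) (j : Fin 3) :
    approx q hq n s a (q j) = a j := by
  induction n generalizing s a j with
  | zero => simp [approx, bary_vertex]
  | succ n ih =>
    have := glue_F hq (g := fun i => approx q hq n (s / 5) (subdiv s i a))
      (fun i l _ => by simp only [ih, subdiv_comm]) j (vertex_mem_SG j)
    rw [F_self] at this
    rw [approx, this, ih, subdiv, if_pos rfl]

theorem approx_F (hq : IsEquilateral q) (n : ℕ) (s : ℝ) (a : Fin 3 → ℝ) (i : Fin 3) {x : Plane} (hx : x ∈ SG q) :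
    approx q hq (n + 1) s a (F q i x) = approx q hq n (s / 5) (subdiv s i a) x :=
  glue_F hq (g := fun i => approx q hq n (s / 5) (subdiv s i a))
    (fun i l _ => by simp only [approx_vertex, subdiv_comm]) i hx

theorem continuousOn_approx (hq : IsEquilateral q) (n : ℕ) (s : ℝ) (a : Fin 3 → ℝ) :
    ContinuousOn (approx q hq n s a) (SG q) := by
  induction n generalizing s a with
  | zero =>
    refine Continuous.continuousOn ?_
    exact continuous_finsetSum _ fun i _ => continuous_const.mul (continuous_bary hq i)
  | succ n ih =>
    exact continuousOn_glue hq (fun i l _ => by simp only [approx_vertex, subdiv_comm])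
      fun i => ih _ _

/-- The maximum and the minimum of the sum are both pulled halfway towards 1 by each `F q i`, so
both equal 1. -/
theorem sum_bary (hq : IsEquilateral q) {x : Plane} (hx : x ∈ SG q) : ∑ i, bary q hq i x = 1 := by
  have key : ∀ y ∈ SG q, ∀ i, ∑ l, bary q hq l (F q i y) = (1 + ∑ l, bary q hq l y) / 2 := by
    intro y _ i
    simp only [bary_F, bary_vertex, ← Finset.sum_div, Finset.sum_add_distrib, Finset.sum_ite_eq',
      Finset.mem_univ, if_true]
  have hc : Continuous fun x => ∑ i, bary q hq i x :=
    continuous_finsetSum _ fun i _ => continuous_bary hq i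
  obtain ⟨z, hz, hmax⟩ := (isCompact_SG q).exists_isMaxOn (SG_nonempty q) hc.continuousOn
  obtain ⟨z', hz', hmin⟩ := (isCompact_SG q).exists_isMinOn (SG_nonempty q) hc.continuousOn
  obtain ⟨j, y, hy, rfl⟩ := exists_F_eq hz
  obtain ⟨j', y', hy', rfl⟩ := exists_F_eq hz'
  have h1 := isMaxOn_iff.1 hmax y hy
  have h2 := isMaxOn_iff.1 hmax x hx
  have h3 := isMinOn_iff.1 hmin y' hy'
  have h4 := isMinOn_iff.1 hmin x hx
  rw [key y hy] at h1 h2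
  rw [key y' hy'] at h3 h4
  linarith

theorem abs_approx_zero_sub_le (hq : IsEquilateral q) {D : ℝ} {a : Fin 3 → ℝ} {t : ℝ} (h : ∀ i, |a i - t| ≤ D) {x : Plane}
    (hx : x ∈ SG q) : |approx q hq 0 s a x - t| ≤ D := by
  have h1 : approx q hq 0 s a x - t = ∑ i, bary q hq i x * (a i - t) := by
    simp only [approx, mul_sub, Finset.sum_sub_distrib, ← Finset.sum_mul, sum_bary hq hx, one_mul]
    congr 1
    exact Finset.sum_congr rfl fun i _ => mul_comm _ _
  rw [h1]
  calc |∑ i, bary q hq i x * (a i - t)| ≤ ∑ i, |bary q hq i x * (a i - t)| :=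
        Finset.abs_sum_le_sum_abs _ _
    _ ≤ ∑ i, bary q hq i x * D := by
        refine Finset.sum_le_sum fun i _ => ?_
        rw [abs_mul, abs_of_nonneg (bary_nonneg hq i hx)]
        exact mul_le_mul_of_nonneg_left (h i) (bary_nonneg hq i hx)
    _ = D := by rw [← Finset.sum_mul, sum_bary hq hx, one_mul]

theorem abs_approx_succ_sub_le (hq : IsEquilateral q) (n : ℕ) {D : ℝ} {a : Fin 3 → ℝ} (h : OscBound s D a) {x : Plane}
    (hx : x ∈ SG q) : |approx q hq (n + 1) s a x - approx q hq n s a x| ≤ 2 * D * (3 / 5) ^ n := by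
  induction n generalizing s a D x with
  | zero =>
    obtain ⟨i, y, hy, rfl⟩ := exists_F_eq hx
    rw [zero_add, approx_F hq 0 s a i hy]
    have h1 := abs_approx_zero_sub_le hq (s := s / 5) (t := a 0)
      (fun j => h.abs_subdiv_sub_le i j 0) hy
    have h2 := abs_approx_zero_sub_le hq (s := s) (t := a 0) (D := D) (a := a)
      (fun j => abs_le.2 ⟨by linarith [h 0 j, abs_nonneg s], by linarith [h j 0, abs_nonneg s]⟩) hx
    have h3 := abs_sub_le (approx q hq 0 (s / 5) (subdiv s i a) y) (a 0)
      (approx q hq 0 s a (F q i y))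
    rw [abs_sub_comm (a 0)] at h3
    linarith
  | succ n ih =>
    obtain ⟨i, y, hy, rfl⟩ := exists_F_eq hx
    rw [approx_F hq _ s a i hy, approx_F hq _ s a i hy]
    refine (ih (h.subdiv i) hy).trans (le_of_eq ?_)
    ring

/-- There is a continuous function obeying the subdivision rule, with any given boundary values. -/
theorem exists_subdivides (hq : IsEquilateral q) (s : ℝ) (a : Fin 3 → ℝ) :
    ∃ u : Plane → ℝ, ContinuousOn u (SG q) ∧ Subdivides q s u ∧ ∀ i, u (q i) = a i := by
  -- The limit of the approximations, written as a telescoping series so that the geometric bound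
  -- yields continuity.
  set L : ℝ → (Fin 3 → ℝ) → Plane → ℝ := fun s a x =>
    approx q hq 0 s a x + ∑' n, (approx q hq (n + 1) s a x - approx q hq n s a x) with hL
  have hlim : ∀ s a, ∀ x ∈ SG q, Tendsto (fun n => approx q hq n s a x) atTop (𝓝 (L s a x)) := by
    intro s a x hx
    obtain ⟨D, hD⟩ := exists_oscBound s a
    have hs : Summable fun n => approx q hq (n + 1) s a x - approx q hq n s a x :=
      Summable.of_norm_bounded
        ((summable_geometric_of_lt_one (by norm_num) (by norm_num : (3 / 5 : ℝ) < 1)).mul_left (2 * D))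
        fun n => by simpa using abs_approx_succ_sub_le hq n hD hx
    have h1 := hs.hasSum.tendsto_sum_nat.const_add (approx q hq 0 s a x)
    refine h1.congr fun n => ?_
    rw [Finset.sum_range_sub (fun n => approx q hq n s a x)]
    ring
  have hcont : ∀ s a, ContinuousOn (L s a) (SG q) := by
    intro s a
    obtain ⟨D, hD⟩ := exists_oscBound s a
    refine (continuousOn_approx hq 0 s a).add (continuousOn_tsum
      (fun n => (continuousOn_approx hq (n + 1) s a).sub (continuousOn_approx hq n s a))
      ((summable_geometric_of_lt_one (by norm_num) (by norm_num : (3 / 5 : ℝ) < 1)).mul_left (2 * D))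
      fun n x hx => by simpa using abs_approx_succ_sub_le hq n hD hx)
  have hvert : ∀ s a i, L s a (q i) = a i := by
    intro s a i
    refine tendsto_nhds_unique (hlim s a _ (vertex_mem_SG i)) ?_
    simp only [approx_vertex]
    exact tendsto_const_nhds
  have hF : ∀ s a i, ∀ x ∈ SG q, L s a (F q i x) = L (s / 5) (subdiv s i a) x := by
    intro s a i x hx
    refine tendsto_nhds_unique ((tendsto_add_atTop_iff_nat 1).2 (hlim s a _ (F_mem_SG hx i))) ?_
    simp only [approx_F hq _ s a i hx]
    exact hlim _ _ x hx
  have hsub : ∀ w : List (Fin 3), ∀ s a i j, L s a (Fword q w (F q i (q j))) =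
      subdiv (s * (1 / 5) ^ w.length) i (fun l => L s a (Fword q w (q l))) j := by
    intro w
    induction w with
    | nil =>
      intro s a i j
      simp only [Fword_nil, List.length_nil, pow_zero, mul_one, hvert]
      rw [hF s a i _ (vertex_mem_SG j), hvert]
    | cons b w ih =>
      intro s a i j
      simp only [Fword_cons, List.length_cons, pow_succ']
      rw [hF s a b _ (Fword_mem_SG (F_mem_SG (vertex_mem_SG j) i) w), ih, ← mul_assoc,
        ← div_eq_mul_one_div]
      congr 1
      funext l
      rw [hF s a b _ (Fword_vertex_mem_SG w l)]
  exact ⟨L s a, hcont s a, fun w i j => hsub w s a i j, hvert s a⟩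

/-! ### Bounds from corner values -/

theorem subdiv_le {M : ℝ} (hs : 0 ≤ s) {a : Fin 3 → ℝ} (h : ∀ j, a j ≤ M) (i j : Fin 3) :
    subdiv s i a j ≤ M := by
  unfold subdiv
  split_ifs with hij
  · exact h i
  · obtain ⟨m, hmi, hmj⟩ := exists_third i j hij
    rw [sum_third hij hmi hmj]
    linarith [h i, h j, h m]

theorem le_subdiv {c : ℝ} (hs : 0 ≤ s) {a : Fin 3 → ℝ} (h : ∀ j, c ≤ a j) (i j : Fin 3) :
    c - s / 15 ≤ subdiv s i a j := by
  unfold subdiv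
  split_ifs with hij
  · linarith [h i]
  · obtain ⟨m, hmi, hmj⟩ := exists_third i j hij
    rw [sum_third hij hmi hmj]
    linarith [h i, h j, h m]

/-- Each subdivision lowers the minimum by at most s/15 and divides s by 5; the losses add up to
(s/15)(1 + 1/5 + ...) = s/12. The maximum never grows. -/
theorem Subdivides.corner_bounds (hs : 0 ≤ s) (h : Subdivides q s u) {c M : ℝ}
    (hc : ∀ j, c ≤ u (q j)) (hM : ∀ j, u (q j) ≤ M) (w : List (Fin 3)) (j : Fin 3) :
    c - s / 12 ≤ u (Fword q w (q j)) ∧ u (Fword q w (q j)) ≤ M := by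
  induction w generalizing s u c with
  | nil =>
    rw [Fword_nil]
    exact ⟨by linarith [hc j], hM j⟩
  | cons i w ih =>
    have := ih (by positivity) (h.comp_F i) (c := c - s / 15)
      (fun l => by simp only [h.root]; exact le_subdiv hs hc i l)
      (fun l => by simp only [h.root]; exact subdiv_le hs hM i l)
    rw [Fword_cons]
    exact ⟨by linarith [this.1], this.2⟩

/-- Every point of the gasket is a limit of corners of cells. -/
theorem exists_tendsto_corner {x : Plane} (hx : x ∈ SG q) :
    ∃ w : ℕ → List (Fin 3), Tendsto (fun n => Fword q (w n) (q 0)) atTop (𝓝 x) := by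
  have key : ∀ n, ∀ x ∈ SG q, ∃ w : List (Fin 3), w.length = n ∧ ∃ y ∈ SG q, Fword q w y = x := by
    intro n
    induction n with
    | zero => exact fun x hx => ⟨[], rfl, x, hx, rfl⟩
    | succ n ih =>
      intro x hx
      obtain ⟨i, y, hy, rfl⟩ := exists_F_eq hx
      obtain ⟨w, hw, z, hz, rfl⟩ := ih y hy
      exact ⟨i :: w, by simp [hw], z, hz, rfl⟩
  choose w hw y hy hxy using fun n => key n x hx
  refine ⟨w, ?_⟩
  rw [tendsto_iff_dist_tendsto_zero]
  have hbound : Tendsto (fun n : ℕ => (1 / 2 : ℝ) ^ n * Metric.diam (SG q)) atTop (𝓝 0) := by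
    have := (tendsto_pow_atTop_nhds_zero_of_lt_one (by norm_num : (0 : ℝ) ≤ 1 / 2)
      (by norm_num)).mul_const (Metric.diam (SG q))
    simpa using this
  refine squeeze_zero (fun _ => dist_nonneg) (fun n => ?_) hbound
  conv_lhs => rw [← hxy n]
  rw [dist_Fword, hw]
  gcongr
  exact Metric.dist_le_diam_of_mem (isCompact_SG q).isBounded (vertex_mem_SG 0) (hy n)

theorem Subdivides.bounds (hs : 0 ≤ s) (hu : ContinuousOn u (SG q)) (h : Subdivides q s u) {c M : ℝ}
    (hc : ∀ j, c ≤ u (q j)) (hM : ∀ j, u (q j) ≤ M) {x : Plane} (hx : x ∈ SG q) :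
    c - s / 12 ≤ u x ∧ u x ≤ M := by
  obtain ⟨w, hw⟩ := exists_tendsto_corner hx
  have h1 : Tendsto (fun n => u (Fword q (w n) (q 0))) atTop (𝓝 (u x)) :=
    (hu x hx).tendsto.comp (tendsto_nhdsWithin_iff.2
      ⟨hw, Eventually.of_forall fun n => Fword_vertex_mem_SG (w n) 0⟩)
  exact ⟨ge_of_tendsto' h1 fun n => (h.corner_bounds hs hc hM (w n) 0).1,
    le_of_tendsto' h1 fun n => (h.corner_bounds hs hc hM (w n) 0).2⟩

/-- The mean value of a function with constant Laplacian. -/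
theorem Subdivides.integral_eq (hs : 0 ≤ s) (hu : ContinuousOn u (SG q)) (h : Subdivides q s u) :
    ∫ x, u x ∂(μ q) = (∑ i, u (q i)) / 3 - s / 18 := by
  -- The formula is a fixed point of averaging over the three subcells: c = 2s/45 + c/5 has the
  -- solution c = s/18. A crude error bound therefore shrinks by 3/5 per level.
  have key : ∀ n : ℕ, ∀ s u, 0 ≤ s → ContinuousOn u (SG q) → Subdivides q s u →
      ∀ D, OscBound s D (fun i => u (q i)) →
      |∫ x, u x ∂(μ q) - ((∑ i, u (q i)) / 3 - s / 18)| ≤ 2 * D * (3 / 5) ^ n := by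
    intro n
    induction n with
    | zero =>
      intro s u hs hu h D hD
      have hb : ∀ x ∈ SG q, u (q 0) - (D - s / 6) - s / 12 ≤ u x ∧ u x ≤ u (q 0) + (D - s / 6) := by
        intro x hx
        refine h.bounds hs hu (fun j => ?_) (fun j => ?_) hx
        · have := hD 0 j; rw [abs_of_nonneg hs] at this; linarith
        · have := hD j 0; rw [abs_of_nonneg hs] at this; linarith
      have hi := integrable_of_continuousOn hu
      have h1 : u (q 0) - (D - s / 6) - s / 12 ≤ ∫ x, u x ∂(μ q) := by
        have := integral_mono_ae (integrable_const _) hi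
          ((ae_mem_SG q).mono fun x hx => (hb x hx).1)
        simpa using this
      have h2 : ∫ x, u x ∂(μ q) ≤ u (q 0) + (D - s / 6) := by
        have := integral_mono_ae hi (integrable_const _)
          ((ae_mem_SG q).mono fun x hx => (hb x hx).2)
        simpa using this
      have e1 := hD 0 1; have e2 := hD 1 0; have e3 := hD 0 2; have e4 := hD 2 0
      rw [abs_of_nonneg hs] at e1 e2 e3 e4
      simp only at e1 e2 e3 e4
      rw [Fin.sum_univ_three, abs_le]
      constructor <;> linarith
    | succ n ih =>
      intro s u hs hu h D hD
      have e : ∀ i, |∫ x, u (F q i x) ∂(μ q) - ((∑ j, u (F q i (q j))) / 3 - s / 5 / 18)| ≤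
          2 * D * (3 / 5) ^ (n + 1) := by
        intro i
        have h1 : OscBound (s / 5) (3 / 5 * D) (fun j => u (F q i (q j))) := by
          simp only [h.root]
          exact hD.subdiv i
        refine (ih (s / 5) _ (by positivity) (continuousOn_comp_F hu i) (h.comp_F i) _ h1).trans
          (le_of_eq ?_)
        ring
      rw [integral_μ_eq (integrable_of_continuousOn hu)]
      have e0 := e 0; have e1 := e 1; have e2 := e 2
      simp only [h.root, sum_subdiv] at e0 e1 e2
      simp only [Fin.sum_univ_three] at e0 e1 e2 ⊢
      rw [abs_le] at e0 e1 e2 ⊢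
      constructor <;> linarith
  obtain ⟨D, hD⟩ := exists_oscBound s (fun i => u (q i))
  have hlim : Tendsto (fun n : ℕ => 2 * D * (3 / 5 : ℝ) ^ n) atTop (𝓝 0) := by
    have := (tendsto_pow_atTop_nhds_zero_of_lt_one (by norm_num : (0 : ℝ) ≤ 3 / 5)
      (by norm_num)).const_mul (2 * D)
    simpa using this
  have := ge_of_tendsto' hlim fun n => key n s u hs hu h D hD
  exact sub_eq_zero.1 (abs_nonpos_iff.1 this)

end

/-! ### Cellwise description of the graph energies -/

section
variable {q : Fin 3 → Plane} {s : ℝ} {u : Plane → ℝ}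

theorem mem_V {m : ℕ} {x : Plane} :
    x ∈ V q m ↔ ∃ w : List (Fin 3), w.length = m ∧ ∃ i, Fword q w (q i) = x := by
  induction m generalizing x with
  | zero => simp [V]
  | succ m ih =>
    simp only [V, Finset.mem_biUnion, Finset.mem_univ, true_and, Finset.mem_image, ih]
    constructor
    · rintro ⟨i, _, ⟨w, hw, j, rfl⟩, rfl⟩
      exact ⟨i :: w, by simp [hw], j, rfl⟩
    · rintro ⟨w, hw, j, rfl⟩
      cases w with
      | nil => simp at hw
      | cons i w => exact ⟨i, _, ⟨w, by simpa using hw, j, rfl⟩, rfl⟩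

theorem mem_nbrs {m : ℕ} {x y : Plane} : y ∈ nbrs q m x ↔ y ∈ V q m ∧ Adj q m x y := by
  simp [nbrs]

/-- Each oriented edge lies in exactly one cell of level m, and the diagonal terms vanish by `hG`.
-/
theorem sum_edges (hq : IsEquilateral q) (m : ℕ) (G : Plane → Plane → ℝ) (hG : ∀ x, G x x = 0) :
    ∑ x ∈ V q m, ∑ y ∈ nbrs q m x, G x y =
      ∑ w ∈ words m, ∑ i, ∑ j, G (Fword q w (q i)) (Fword q w (q j)) := by
  classical
  rw [Finset.sum_sigma']
  simp only [← Finset.sum_product']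
  rw [← Finset.sum_filter_of_ne (p := fun p : List (Fin 3) × Fin 3 × Fin 3 => p.2.1 ≠ p.2.2)]
  swap
  · rintro ⟨w, i, j⟩ _ h hij
    simp only at h hij
    exact h (by rw [hij, hG])
  symm
  refine Finset.sum_nbij (fun p => ⟨Fword q p.1 (q p.2.1), Fword q p.1 (q p.2.2)⟩) ?_ ?_ ?_ ?_
  · rintro ⟨w, i, j⟩ h
    simp only [Finset.mem_filter, Finset.mem_product, mem_words, Finset.mem_univ, and_true] at h
    obtain ⟨hw, hij⟩ := h
    simp only [Finset.mem_sigma, mem_nbrs, mem_V]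
    refine ⟨⟨w, hw, i, rfl⟩, ⟨w, hw, j, rfl⟩, ?_, w, hw, ⟨i, rfl⟩, j, rfl⟩
    exact fun e => hij (vertex_injective hq (Fword_injective q w e))
  · rintro ⟨w, i, j⟩ h ⟨w', i', j'⟩ h' e
    simp only [Finset.coe_filter, Finset.mem_product, mem_words, Finset.mem_univ, and_true,
      Set.mem_ofPred_eq] at h h'
    simp only [Sigma.mk.injEq, heq_eq_eq] at e
    obtain ⟨e1, e2⟩ := e
    by_cases hww : w = w'
    · subst hww
      rw [vertex_injective hq (Fword_injective q w e1),
        vertex_injective hq (Fword_injective q w e2)]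
    · obtain ⟨τ, a, b, n, hab, h1, h2, h3, h4⟩ := Fword_eq_Fword hq (h.1.trans h'.1.symm) hww
        (vertex_mem_SG i) (vertex_mem_SG i') e1
      obtain ⟨τ', a', b', n', hab', h1', h2', h3', h4'⟩ :=
        Fword_eq_Fword hq (h.1.trans h'.1.symm) hww (vertex_mem_SG j) (vertex_mem_SG j') e2
      obtain ⟨-, rfl⟩ := append_cons_replicate_pair_inj hab hab' (h1.symm.trans h1')
        (h2.symm.trans h2')
      exact absurd (vertex_injective hq (h3.trans h3'.symm)) h.2
  · rintro ⟨x, y⟩ h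
    simp only [Finset.coe_sigma, Set.mem_sigma_iff, Finset.mem_coe, mem_nbrs] at h
    obtain ⟨-, -, hne, w, hw, ⟨i, rfl⟩, j, rfl⟩ := h
    refine ⟨(w, i, j), ?_, rfl⟩
    simp only [Finset.coe_filter, Finset.mem_product, mem_words, Finset.mem_univ, and_true,
      Set.mem_ofPred_eq]
    exact ⟨hw, fun e => hne (by rw [e])⟩
  · rintro ⟨w, i, j⟩ _
    rfl

/-- The energy form of the graph `Γ_0`. -/
def triangleForm (q : Fin 3 → Plane) (u v : Plane → ℝ) : ℝ :=
  (1 / 2) * ∑ i, ∑ j, (u (q i) - u (q j)) * (v (q i) - v (q j))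

/-- The renormalized graph energy as a sum over cells. -/
def cellEnergy (q : Fin 3 → Plane) (m : ℕ) (u v : Plane → ℝ) : ℝ :=
  (5 / 3) ^ m * ∑ w ∈ words m,
    triangleForm q (fun x => u (Fword q w x)) (fun x => v (Fword q w x))

theorem graphEnergy_eq (hq : IsEquilateral q) (m : ℕ) (u v : Plane → ℝ) :
    graphEnergy q m u v = cellEnergy q m u v := by
  rw [graphEnergy, sum_edges hq m (fun x y => (u x - u y) * (v x - v y)) (fun x => by simp),
    cellEnergy, ← inv_pow, inv_div, Finset.mul_sum]
  rfl

theorem cellEnergy_zero (u v : Plane → ℝ) : cellEnergy q 0 u v = triangleForm q u v := by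
  simp [cellEnergy, sum_words_zero]

theorem cellEnergy_succ (m : ℕ) (u v : Plane → ℝ) :
    cellEnergy q (m + 1) u v =
      (5 / 3) * ∑ i, cellEnergy q m (fun x => u (F q i x)) (fun x => v (F q i x)) := by
  simp only [cellEnergy, sum_words_succ, pow_succ', mul_assoc, ← Finset.mul_sum]
  rfl

theorem cellEnergy_congr {u u' v v' : Plane → ℝ} (hu : ∀ x ∈ SG q, u x = u' x)
    (hv : ∀ x ∈ SG q, v x = v' x) (m : ℕ) : cellEnergy q m u v = cellEnergy q m u' v' := by
  simp only [cellEnergy, triangleForm, hu _ (Fword_vertex_mem_SG _ _),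
    hv _ (Fword_vertex_mem_SG _ _)]

theorem cellEnergy_comm (m : ℕ) (u v : Plane → ℝ) : cellEnergy q m u v = cellEnergy q m v u := by
  simp only [cellEnergy, triangleForm, mul_comm (u _ - u _)]

/-- The average of `u` over the corners of the cells of level `m`. -/
def cornerAverage (q : Fin 3 → Plane) (m : ℕ) (u : Plane → ℝ) : ℝ :=
  (1 / 3) ^ m * ∑ w ∈ words m, (∑ i, u (Fword q w (q i))) / 3

theorem cornerAverage_zero (u : Plane → ℝ) : cornerAverage q 0 u = (∑ i, u (q i)) / 3 := by
  simp [cornerAverage, sum_words_zero]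

theorem cornerAverage_succ (m : ℕ) (u : Plane → ℝ) :
    cornerAverage q (m + 1) u = (1 / 3) * ∑ i, cornerAverage q m (fun x => u (F q i x)) := by
  simp only [cornerAverage, sum_words_succ, pow_succ', mul_assoc, ← Finset.mul_sum]
  rfl

theorem subdiv_of_ne (s : ℝ) {i j : Fin 3} (h : i ≠ j) (a : Fin 3 → ℝ) :
    subdiv s i a j = (a i + a j + ∑ l, a l) / 5 - s / 15 := if_neg h

/-- For s = 0 the rule makes u discrete harmonic at the midpoints, so the midpoint values of v drop
out. The shift by s/15 gives each of them the coefficient (5/3)(-2s/15) = -2s/9, and 2/9 is its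
weight in `cornerAverage q 1 v`. -/
theorem Subdivides.cellEnergy_one (h : Subdivides q s u) (v : Plane → ℝ) :
    cellEnergy q 1 u v = cellEnergy q 0 u v - s * (cornerAverage q 1 v - cornerAverage q 0 v) := by
  have h01 := h.root 0 1
  have h02 := h.root 0 2
  have h12 := h.root 1 2
  rw [subdiv_of_ne _ (by decide), Fin.sum_univ_three] at h01 h02 h12
  rw [← zero_add 1, cellEnergy_succ, cornerAverage_succ]
  simp only [cellEnergy_zero, cornerAverage_zero, triangleForm, Fin.sum_univ_three, F_self]
  rw [F_comm q 1 0, F_comm q 2 0, F_comm q 2 1, h01, h02, h12]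
  ring

/-- The effect of a refinement of the graph on the energy. -/
theorem Subdivides.cellEnergy_succ_eq (h : Subdivides q s u) (m : ℕ) (v : Plane → ℝ) :
    cellEnergy q (m + 1) u v =
      cellEnergy q m u v - s * (cornerAverage q (m + 1) v - cornerAverage q m v) := by
  induction m generalizing s u v with
  | zero => exact h.cellEnergy_one v
  | succ m ih =>
    rw [cellEnergy_succ, Finset.sum_congr rfl fun i _ => ih (h.comp_F i) (fun x => v (F q i x)),
      cellEnergy_succ m, cornerAverage_succ, cornerAverage_succ m, Finset.sum_sub_distrib,
      ← Finset.mul_sum, Finset.sum_sub_distrib]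
    ring

/-- The Gauss–Green formula for the graph energies. -/
theorem Subdivides.cellEnergy_eq (h : Subdivides q s u) (m : ℕ) (v : Plane → ℝ) :
    cellEnergy q m u v =
      triangleForm q u v - s * (cornerAverage q m v - (∑ i, v (q i)) / 3) := by
  induction m with
  | zero => rw [cellEnergy_zero, cornerAverage_zero]; ring
  | succ m ih => rw [h.cellEnergy_succ_eq, ih]; ring

theorem tendsto_cornerAverage (hu : ContinuousOn u (SG q)) :
    Tendsto (fun m => cornerAverage q m u) atTop (𝓝 (∫ x, u x ∂(μ q))) := by
  rw [Metric.tendsto_atTop]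
  intro ε hε
  have huc := (isCompact_SG q).uniformContinuousOn_of_continuous hu
  obtain ⟨δ, hδ, hd⟩ := Metric.uniformContinuousOn_iff.1 huc (ε / 2) (by positivity)
  have hlim : Tendsto (fun n : ℕ => (1 / 2 : ℝ) ^ n * Metric.diam (SG q)) atTop (𝓝 0) := by
    have := (tendsto_pow_atTop_nhds_zero_of_lt_one (by norm_num : (0 : ℝ) ≤ 1 / 2)
      (by norm_num)).mul_const (Metric.diam (SG q))
    simpa using this
  obtain ⟨N, hN⟩ := eventually_atTop.1 (hlim.eventually (gt_mem_nhds hδ))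
  refine ⟨N, fun m hm => ?_⟩
  have hcell : ∀ w ∈ words m,
      |(∑ i, u (Fword q w (q i))) / 3 - ∫ x, u (Fword q w x) ∂(μ q)| ≤ ε / 2 := by
    intro w hw
    have hi := integrable_of_continuousOn (continuousOn_comp_Fword hu w)
    have hb : ∀ x ∈ SG q, ∀ i, |u (Fword q w x) - u (Fword q w (q i))| ≤ ε / 2 := by
      intro x hx i
      refine (hd _ (Fword_mem_SG hx w) _ (Fword_vertex_mem_SG w i) ?_).le
      rw [dist_Fword, mem_words.1 hw]
      refine lt_of_le_of_lt ?_ (hN m hm)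
      gcongr
      exact Metric.dist_le_diam_of_mem (isCompact_SG q).isBounded hx (vertex_mem_SG i)
    have h1 : (∑ i, u (Fword q w (q i))) / 3 - ε / 2 ≤ ∫ x, u (Fword q w x) ∂(μ q) := by
      have := integral_mono_ae (integrable_const ((∑ i, u (Fword q w (q i))) / 3 - ε / 2)) hi
        ((ae_mem_SG q).mono fun x hx => by
          have e := fun i => abs_le.1 (hb x hx i)
          rw [Fin.sum_univ_three]
          linarith [(e 0).1, (e 1).1, (e 2).1])
      simpa using this
    have h2 : ∫ x, u (Fword q w x) ∂(μ q) ≤ (∑ i, u (Fword q w (q i))) / 3 + ε / 2 := by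
      have := integral_mono_ae hi (integrable_const ((∑ i, u (Fword q w (q i))) / 3 + ε / 2))
        ((ae_mem_SG q).mono fun x hx => by
          have e := fun i => abs_le.1 (hb x hx i)
          rw [Fin.sum_univ_three]
          linarith [(e 0).2, (e 1).2, (e 2).2])
      simpa using this
    rw [abs_le]
    constructor <;> linarith
  rw [integral_μ_eq_sum_words (integrable_of_continuousOn hu) m, cornerAverage, Real.dist_eq,
    ← mul_sub, ← Finset.sum_sub_distrib, abs_mul, abs_of_nonneg (by positivity)]
  calc (1 / 3 : ℝ) ^ m *
        |∑ w ∈ words m, ((∑ i, u (Fword q w (q i))) / 3 - ∫ x, u (Fword q w x) ∂(μ q))|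
      ≤ (1 / 3 : ℝ) ^ m * ∑ _w ∈ words m, ε / 2 := by
        gcongr
        exact (Finset.abs_sum_le_sum_abs _ _).trans (Finset.sum_le_sum hcell)
    _ = ε / 2 := by
        rw [Finset.sum_const, card_words, nsmul_eq_mul, ← mul_assoc]
        push_cast
        rw [← mul_pow]
        norm_num
    _ < ε := by linarith

theorem Subdivides.tendsto_graphEnergy (hq : IsEquilateral q) (h : Subdivides q s u)
    {v : Plane → ℝ} (hv : ContinuousOn v (SG q)) :
    Tendsto (fun m => graphEnergy q m u v) atTop
      (𝓝 (triangleForm q u v - s * (∫ x, v x ∂(μ q) - (∑ i, v (q i)) / 3))) := by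
  simp only [graphEnergy_eq hq, h.cellEnergy_eq]
  exact (((tendsto_cornerAverage hv).sub_const _).const_mul s).const_sub _

theorem vertex_mem_V (i : Fin 3) : q i ∈ V q 0 := mem_V.2 ⟨[], rfl, i, rfl⟩

theorem Subdivides.hasLaplacian (hq : IsEquilateral q) (hu : ContinuousOn u (SG q))
    (h : Subdivides q s u) : HasLaplacian q u (fun _ => s) := by
  refine ⟨continuousOn_const, ⟨hu, _, h.tendsto_graphEnergy hq hu⟩, fun φ hφ => ?_⟩
  have h1 := h.tendsto_graphEnergy hq hφ.1.1
  have h2 : ∀ i, φ (q i) = 0 := fun i => hφ.2 _ (vertex_mem_V i)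
  simp only [triangleForm, h2, sub_self, mul_zero, Finset.sum_const_zero, zero_div, sub_zero,
    zero_sub] at h1
  rwa [integral_const_mul]

end

/-! ### The subdivision rule from the weak Laplacian -/

section
variable {q : Fin 3 → Plane}

/-- A function supported in the cell `C_w`, harmonic on its three subcells, with values `c i j` at the
points `F_w (F_i (q j))`. -/
theorem exists_bump (hq : IsEquilateral q) (c : Fin 3 → Fin 3 → ℝ) (hc : ∀ i j, c i j = c j i)
    (hc0 : ∀ i, c i i = 0) (w : List (Fin 3)) :
    ∃ φ : Plane → ℝ, ContinuousOn φ (SG q) ∧ (∀ i, φ (q i) = 0) ∧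
      (∀ (v : Plane → ℝ) (m : ℕ), cellEnergy q (m + (w.length + 1)) φ v =
        (5 / 3) ^ (w.length + 1) * ∑ i, (1 / 2) * ∑ j, ∑ l, (c i j - c i l) *
          (v (Fword q w (F q i (q j))) - v (Fword q w (F q i (q l))))) ∧
      ∫ x, φ x ∂(μ q) = (1 / 3) ^ (w.length + 1) * ∑ i, (∑ j, c i j) / 3 := by
  induction w with
  | nil =>
    choose g hgc hgs hgv using fun i => exists_subdivides hq 0 (c i)
    have hg : ∀ i j, i ≠ j → g i (q j) = g j (q i) := fun i j _ => by rw [hgv, hgv, hc]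
    have hφ : ∀ i, ∀ x ∈ SG q, glue q g (F q i x) = g i x := fun i x hx => glue_F hq hg i hx
    refine ⟨glue q g, continuousOn_glue hq hg hgc, fun i => ?_, fun v m => ?_, ?_⟩
    · have := hφ i (q i) (vertex_mem_SG i)
      rwa [F_self, hgv, hc0] at this
    · rw [List.length_nil, zero_add, pow_one, cellEnergy_succ]
      congr 1
      refine Finset.sum_congr rfl fun i _ => ?_
      -- For harmonic pieces the energy against any v is the same at all levels, so the identity
      -- holds for each m and not just in the limit.
      rw [cellEnergy_congr (hφ i) (fun _ _ => rfl), (hgs i).cellEnergy_eq, zero_mul, sub_zero]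
      simp only [triangleForm, hgv, Fword_nil]
    · rw [integral_μ_eq (integrable_of_continuousOn (continuousOn_glue hq hg hgc)),
        List.length_nil, zero_add, pow_one]
      congr 1
      refine Finset.sum_congr rfl fun i _ => ?_
      rw [integral_congr_ae ((ae_mem_SG q).mono fun x hx => hφ i x hx),
        (hgs i).integral_eq le_rfl (hgc i)]
      simp only [hgv, zero_div, sub_zero]
  | cons b w ih =>
    obtain ⟨φ, hφc, hφ0, hφe, hφi⟩ := ih
    -- Extension by zero to the other two cells, which is consistent because φ vanishes at the
    -- boundary.
    set g : Fin 3 → Plane → ℝ := fun i x => if i = b then φ x else 0 with hgdef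
    have hgv : ∀ i j, g i (q j) = 0 := fun i j => by simp [hgdef, hφ0]
    have hg : ∀ i j, i ≠ j → g i (q j) = g j (q i) := fun i j _ => by rw [hgv, hgv]
    have hgc : ∀ i, ContinuousOn (g i) (SG q) := by
      intro i
      by_cases hi : i = b
      · simpa [hgdef, hi] using hφc
      · simpa [hgdef, hi] using continuousOn_const
    have hψ : ∀ i, ∀ x ∈ SG q, glue q g (F q i x) = g i x := fun i x hx => glue_F hq hg i hx
    have hb : ∀ i, i ≠ b → ∀ x, g i x = 0 := fun i hi x => if_neg hi
    have hbb : ∀ x, g b x = φ x := fun x => if_pos rfl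
    refine ⟨glue q g, continuousOn_glue hq hg hgc, fun i => ?_, fun v m => ?_, ?_⟩
    · have := hψ i (q i) (vertex_mem_SG i)
      rwa [F_self, hgv] at this
    · rw [List.length_cons, ← add_assoc, cellEnergy_succ, Finset.sum_eq_single b]
      · rw [cellEnergy_congr (u' := φ) (fun x hx => (hψ b x hx).trans (hbb x)) (fun _ _ => rfl),
          hφe, pow_succ' _ (w.length + 1), mul_assoc]
        rfl
      · intro i _ hi
        rw [cellEnergy_congr (u' := fun _ => 0) (fun x hx => (hψ i x hx).trans (hb i hi x))
          (fun _ _ => rfl)]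
        simp [cellEnergy, triangleForm]
      · simp
    · rw [integral_μ_eq (integrable_of_continuousOn (continuousOn_glue hq hg hgc)),
        List.length_cons, pow_succ' _ (w.length + 1), mul_assoc, ← hφi, Finset.sum_eq_single b]
      · congr 1
        exact integral_congr_ae ((ae_mem_SG q).mono fun x hx => (hψ b x hx).trans (hbb x))
      · intro i _ hi
        exact integral_eq_zero_of_ae ((ae_mem_SG q).mono fun x hx => (hψ i x hx).trans (hb i hi x))
      · simp

/-- The energies against the bump are eventually constant, so the weak equation becomes a finite
linear identity between values of v. Dividing 1/3 by 5/3 once per level produces the power of 1/5.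
-/
theorem HasLaplacian.bump_identity (hq : IsEquilateral q) {v : Plane → ℝ}
    (hv : HasLaplacian q v fun _ => 1) (c : Fin 3 → Fin 3 → ℝ) (hc : ∀ i j, c i j = c j i)
    (hc0 : ∀ i, c i i = 0) (w : List (Fin 3)) :
    ∑ i, (1 / 2) * ∑ j, ∑ l, (c i j - c i l) *
        (v (Fword q w (F q i (q j))) - v (Fword q w (F q i (q l)))) =
      -((1 / 5) ^ (w.length + 1) * ∑ i, (∑ j, c i j) / 3) := by
  obtain ⟨φ, hφc, hφ0, hφe, hφi⟩ := exists_bump hq c hc hc0 w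
  have hev : ∀ u : Plane → ℝ, Tendsto (fun m => graphEnergy q m u φ) atTop
      (𝓝 ((5 / 3) ^ (w.length + 1) * ∑ i, (1 / 2) * ∑ j, ∑ l, (c i j - c i l) *
        (u (Fword q w (F q i (q j))) - u (Fword q w (F q i (q l)))))) := by
    intro u
    refine (tendsto_add_atTop_iff_nat (w.length + 1)).1 ?_
    simp only [graphEnergy_eq hq, cellEnergy_comm _ u, hφe]
    exact tendsto_const_nhds
  have hφ : DomE₀ q φ := by
    refine ⟨⟨hφc, _, hev φ⟩, fun x hx => ?_⟩
    obtain ⟨w', hw', i, rfl⟩ := mem_V.1 hx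
    rw [List.length_eq_zero_iff.1 hw', Fword_nil, hφ0]
  have h := tendsto_nhds_unique (hev v) (hv.2.2 φ hφ)
  simp only [one_mul, hφi] at h
  have h5 : (1 / 5 : ℝ) ^ (w.length + 1) = (3 / 5) ^ (w.length + 1) * (1 / 3) ^ (w.length + 1) := by
    rw [← mul_pow]; norm_num
  have h6 : (3 / 5 : ℝ) ^ (w.length + 1) * (5 / 3) ^ (w.length + 1) = 1 := by
    rw [← mul_pow]; norm_num
  rw [h5, mul_assoc, ← mul_neg, ← h, ← mul_assoc, h6, one_mul]

/-- A function with Laplacian `1` obeys the subdivision rule. -/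
theorem HasLaplacian.subdivides (hq : IsEquilateral q) {v : Plane → ℝ}
    (hv : HasLaplacian q v fun _ => 1) : Subdivides q 1 v := by
  intro w
  -- One bump for each of the three midpoints gives three linear equations, which determine the
  -- three midpoint values.
  have key : ∀ X Y Z : ℝ, _ := fun X Y Z =>
    hv.bump_identity hq !![0, X, Y; X, 0, Z; Y, Z, 0]
      (fun i j => by fin_cases i <;> fin_cases j <;> rfl)
      (fun i => by fin_cases i <;> rfl) w
  have h1 := key 1 0 0
  have h2 := key 0 1 0
  have h3 := key 0 0 1
  simp only [Fin.sum_univ_three, Matrix.of_apply, Matrix.cons_val_zero, Matrix.cons_val_one,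
    Matrix.cons_val, F_self, F_comm q 1 0, F_comm q 2 0, F_comm q 2 1, pow_succ] at h1 h2 h3
  have e01 : v (Fword q w (F q 0 (q 1))) =
      subdiv (1 * (1 / 5) ^ w.length) 0 (fun l => v (Fword q w (q l))) 1 := by
    rw [subdiv_of_ne _ (by decide), Fin.sum_univ_three]
    linarith
  have e02 : v (Fword q w (F q 0 (q 2))) =
      subdiv (1 * (1 / 5) ^ w.length) 0 (fun l => v (Fword q w (q l))) 2 := by
    rw [subdiv_of_ne _ (by decide), Fin.sum_univ_three]
    linarith
  have e12 : v (Fword q w (F q 1 (q 2))) =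
      subdiv (1 * (1 / 5) ^ w.length) 1 (fun l => v (Fword q w (q l))) 2 := by
    rw [subdiv_of_ne _ (by decide), Fin.sum_univ_three]
    linarith
  have hself : ∀ i, v (Fword q w (F q i (q i))) =
      subdiv (1 * (1 / 5) ^ w.length) i (fun l => v (Fword q w (q l))) i := fun i => by
    rw [F_self, subdiv, if_pos rfl]
  have hcomm : ∀ i j, v (Fword q w (F q i (q j))) =
      subdiv (1 * (1 / 5) ^ w.length) i (fun l => v (Fword q w (q l))) j →
      v (Fword q w (F q j (q i))) =
      subdiv (1 * (1 / 5) ^ w.length) j (fun l => v (Fword q w (q l))) i := fun i j h => by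
    rw [F_comm, h, subdiv_comm]
  intro i j
  fin_cases i <;> fin_cases j
  exacts [hself 0, e01, e02, hcomm 0 1 e01, hself 1, e12, hcomm 0 2 e02, hcomm 1 2 e12, hself 2]

end

/-! ### Values on two cells with a common corner -/

section
variable {q : Fin 3 → Plane} {s : ℝ} {u : Plane → ℝ}

/-- Passing to the next level at the junction point divides both differences by 5, whereas the
quantity multiplied by θ (the sum minus 2p minus e/3) is multiplied by 3/5. Thus θ starts at 1 and
is divided by 3 each time. The identity for the sums is the discrete equation Δ = s at the junction.
-/
theorem Subdivides.junction_root (h : Subdivides q s u) {i j l : Fin 3} (hij : i ≠ j) (hli : l ≠ i)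
    (hlj : l ≠ j) (n : ℕ) :
    let w := i :: List.replicate n j
    let w' := j :: List.replicate n i
    let p := u (Fword q w (q j))
    let e := s * (1 / 5) ^ w.length
    u (Fword q w' (q i)) = p ∧
    u (Fword q w' (q j)) + u (Fword q w' (q l)) =
      4 * p + 2 * e / 3 - (u (Fword q w (q i)) + u (Fword q w (q l))) ∧
    ∃ θ : ℝ, 0 ≤ θ ∧ θ ≤ 1 ∧
      u (Fword q w' (q j)) - u (Fword q w' (q l)) = u (Fword q w (q i)) - u (Fword q w (q l)) -
        4 / 3 * θ * (u (Fword q w (q i)) + u (Fword q w (q l)) - 2 * p - e / 3) := by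
  have hp : ∀ (i j : Fin 3) (n : ℕ),
      u (Fword q (i :: List.replicate n j) (q j)) = u (F q i (q j)) := fun i j n => by
    rw [Fword_cons, Fword_replicate]
  simp only [hp, List.length_cons, List.length_replicate]
  refine ⟨by rw [F_comm], ?_⟩
  induction n with
  | zero =>
    simp only [List.replicate_zero, Fword_cons, Fword_nil, F_self, h.root]
    rw [subdiv_of_ne _ hij, subdiv_of_ne _ hli.symm, subdiv_of_ne _ hlj.symm,
      sum_third hij hli hlj]
    exact ⟨by ring, 1, by norm_num, le_rfl, by ring⟩
  | succ n ih =>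
    have step : ∀ (i j : Fin 3), u (Fword q (i :: List.replicate (n + 1) j) (q l)) =
        subdiv (s * (1 / 5) ^ (n + 1)) j
          (fun m => u (Fword q (i :: List.replicate n j) (q m))) l ∧
        u (Fword q (i :: List.replicate (n + 1) j) (q i)) =
        subdiv (s * (1 / 5) ^ (n + 1)) j
          (fun m => u (Fword q (i :: List.replicate n j) (q m))) i := by
      intro i j
      have e : i :: List.replicate (n + 1) j = (i :: List.replicate n j) ++ [j] := by
        rw [List.replicate_succ', List.cons_append]
      constructor
      · rw [e, Fword_append]
        simpa using h (i :: List.replicate n j) j l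
      · rw [e, Fword_append]
        simpa using h (i :: List.replicate n j) j i
    obtain ⟨h1, θ, hθ0, hθ1, h2⟩ := ih
    rw [(step i j).1, (step i j).2, (step j i).1, (step j i).2, subdiv_of_ne _ hlj.symm,
      subdiv_of_ne _ hij.symm, subdiv_of_ne _ hli.symm, subdiv_of_ne _ hij,
      sum_third hij hli hlj, sum_third hij hli hlj]
    simp only [hp]
    rw [F_comm q j i, pow_succ (1 / 5 : ℝ) (n + 1)]
    refine ⟨by linarith, θ / 3, by linarith, by linarith, ?_⟩
    linear_combination (1 / 5 : ℝ) * h2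

theorem Subdivides.junction (h : Subdivides q s u) (τ : List (Fin 3)) {i j l : Fin 3} (hij : i ≠ j)
    (hli : l ≠ i) (hlj : l ≠ j) (n : ℕ) {w w' : List (Fin 3)}
    (hw : w = τ ++ i :: List.replicate n j) (hw' : w' = τ ++ j :: List.replicate n i) :
    u (Fword q w' (q i)) = u (Fword q w (q j)) ∧
    u (Fword q w' (q j)) + u (Fword q w' (q l)) =
      4 * u (Fword q w (q j)) + 2 * (s * (1 / 5) ^ w.length) / 3 -
        (u (Fword q w (q i)) + u (Fword q w (q l))) ∧
    ∃ θ : ℝ, 0 ≤ θ ∧ θ ≤ 1 ∧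
      u (Fword q w' (q j)) - u (Fword q w' (q l)) = u (Fword q w (q i)) - u (Fword q w (q l)) -
        4 / 3 * θ * (u (Fword q w (q i)) + u (Fword q w (q l)) - 2 * u (Fword q w (q j)) -
          s * (1 / 5) ^ w.length / 3) := by
  have := (h.comp_Fword τ).junction_root hij hli hlj n
  subst hw hw'
  simp only [mul_assoc s] at this
  simp only [Fword_append, List.length_append, pow_add]
  exact this

/-- Continuous functions that obey the harmonic subdivision rule are harmonic. -/
theorem Subdivides.isHarmonic (hq : IsEquilateral q) (hu : ContinuousOn u (SG q))
    (h : Subdivides q 0 u) : IsHarmonic q u := by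
  classical
  refine ⟨hu, fun m x hx hx0 => ?_⟩
  obtain ⟨w, hw, j, rfl⟩ := mem_V.1 hx
  -- A word that is not constantly `j` ends in a run of `j` preceded by another letter, so a
  -- nonboundary vertex is a junction of two cells.
  have hfirst : ∀ w : List (Fin 3), w ≠ List.replicate w.length j →
      ∃ (τ : List (Fin 3)) (i : Fin 3) (n : ℕ), i ≠ j ∧ w = τ ++ i :: List.replicate n j := by
    intro w
    induction w with
    | nil => intro h; exact absurd rfl h
    | cons a w ih =>
      intro hne
      by_cases hw : w = List.replicate w.length j
      · refine ⟨[], a, w.length, fun haj => hne ?_, by rw [List.nil_append, ← hw]⟩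
        rw [List.length_cons, List.replicate_succ, haj, ← hw]
      · obtain ⟨τ, i, n, hij, e⟩ := ih hw
        exact ⟨a :: τ, i, n, hij, by rw [e]; rfl⟩
  obtain ⟨τ, i, n, hij, he⟩ := hfirst w fun e => hx0 (by
    rw [e, Fword_replicate]; exact vertex_mem_V j)
  obtain ⟨l, hli, hlj⟩ := exists_third i j hij
  set w' := τ ++ j :: List.replicate n i with he'
  obtain ⟨h1, h2, -⟩ := h.junction τ hij hli hlj n he he'
  have hlen : w'.length = w.length := by rw [he, he']; simp
  have hne : w ≠ w' := by
    intro e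
    rw [he, he'] at e
    have := List.append_cancel_left e
    simp only [List.cons.injEq] at this
    exact hij this.1
  have hpt : Fword q w' (q i) = Fword q w (q j) := by
    rw [he, he', Fword_append, Fword_append, Fword_cons, Fword_cons, Fword_replicate,
      Fword_replicate, F_comm]
  have hinj : ∀ (v : List (Fin 3)) {a b : Fin 3}, Fword q v (q a) = Fword q v (q b) → a = b :=
    fun v a b e => vertex_injective hq (Fword_injective q v e)
  have hcross : ∀ a b, Fword q w (q a) = Fword q w' (q b) → a = j ∧ b = i := by
    intro a b e
    obtain ⟨τ', i', j', n', hij', f1, f2, f3, f4⟩ :=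
      Fword_eq_Fword hq hlen.symm hne (vertex_mem_SG a) (vertex_mem_SG b) e
    obtain ⟨rfl, rfl⟩ := append_cons_replicate_pair_inj hij hij' (he.symm.trans f1) f2
    exact ⟨vertex_injective hq f3, vertex_injective hq f4⟩
  have hset : nbrs q m (Fword q w (q j)) =
      {Fword q w (q i), Fword q w (q l), Fword q w' (q j), Fword q w' (q l)} := by
    ext y
    simp only [mem_nbrs, Finset.mem_insert, Finset.mem_singleton]
    constructor
    · rintro ⟨-, hne', v, hv, ⟨a, ha⟩, b, rfl⟩
      by_cases hvw : w = v
      · subst hvw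
        obtain rfl := hinj w ha
        rcases eq_third hij hli hlj b with rfl | rfl | rfl
        · exact Or.inl rfl
        · exact absurd rfl hne'
        · exact Or.inr (Or.inl rfl)
      · obtain ⟨j', hj', e1, -⟩ :=
          exists_isNeighbor hq (hw.trans hv.symm) hvw (vertex_mem_SG j) (vertex_mem_SG a) ha
        obtain rfl := vertex_injective hq e1
        obtain rfl := hj'.unique ⟨τ, i, n, hij, he, he'⟩
        rw [← hpt] at ha hne'
        rcases eq_third hij hli hlj b with rfl | rfl | rfl
        · exact absurd rfl hne'
        · exact Or.inr (Or.inr (Or.inl rfl))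
        · exact Or.inr (Or.inr (Or.inr rfl))
    · rintro (rfl | rfl | rfl | rfl)
      · exact ⟨mem_V.2 ⟨w, hw, i, rfl⟩, fun e => hij (hinj w e).symm, w, hw, ⟨j, rfl⟩, i, rfl⟩
      · exact ⟨mem_V.2 ⟨w, hw, l, rfl⟩, fun e => hlj (hinj w e).symm, w, hw, ⟨j, rfl⟩, l, rfl⟩
      · exact ⟨mem_V.2 ⟨w', hlen.trans hw, j, rfl⟩, fun e => hij (hcross j j e).2.symm,
          w', hlen.trans hw, ⟨i, hpt.symm⟩, j, rfl⟩
      · exact ⟨mem_V.2 ⟨w', hlen.trans hw, l, rfl⟩, fun e => hli (hcross j l e).2,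
          w', hlen.trans hw, ⟨i, hpt.symm⟩, l, rfl⟩
  rw [hset, Finset.sum_insert, Finset.sum_insert, Finset.sum_insert, Finset.sum_singleton]
  · linarith
  · rw [Finset.mem_singleton]
    exact fun e => hlj (hinj w' e).symm
  · rw [Finset.mem_insert, Finset.mem_singleton]
    rintro (e | e)
    exacts [hlj (hcross l j e).1, hlj (hcross l l e).1]
  · rw [Finset.mem_insert, Finset.mem_insert, Finset.mem_singleton]
    rintro (e | e | e)
    exacts [hli (hinj w e).symm, hij (hcross i j e).1, hij (hcross i l e).1]

end

/-! ### Functions with prescribed values at the corners of a cell -/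

section
variable {q : Fin 3 → Plane} {s : ℝ} {u : Plane → ℝ}

theorem exists_subdiv_eq (i : Fin 3) (b : Fin 3 → ℝ) : ∃ a, ∀ j, subdiv 0 i a j = b j := by
  obtain ⟨j, hj⟩ := exists_ne i
  obtain ⟨l, hli, hlj⟩ := exists_third i j hj.symm
  -- By `sum_subdiv` with s = 0, the sum of the unknown values is (5 ∑ b - 6 b i) / 3; the midpoint
  -- rule is then solved for each value.
  refine ⟨fun m => if i = m then b i else 5 * b m - b i - (5 * ∑ r, b r - 6 * b i) / 3,
    fun m => ?_⟩
  rcases eq_third hj.symm hli hlj m with rfl | rfl | rfl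
  · simp [subdiv]
  all_goals
    rw [subdiv_of_ne _ (by first | exact hj.symm | exact hli.symm), sum_third hj.symm hli hlj,
      sum_third hj.symm hli hlj]
    simp only [if_true, if_neg hj.symm, if_neg hli.symm]
    ring

theorem exists_harmonic_corner_eq (hq : IsEquilateral q) (w : List (Fin 3)) (b : Fin 3 → ℝ) :
    ∃ h : Plane → ℝ, ContinuousOn h (SG q) ∧ Subdivides q 0 h ∧
      ∀ i, h (Fword q w (q i)) = b i := by
  have key : ∀ w : List (Fin 3), ∃ a : Fin 3 → ℝ, ∀ h : Plane → ℝ, Subdivides q 0 h →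
      (∀ i, h (q i) = a i) → ∀ i, h (Fword q w (q i)) = b i := by
    intro w
    induction w with
    | nil => exact ⟨b, fun h _ ha i => ha i⟩
    | cons j w ih =>
      obtain ⟨a, ha⟩ := ih
      obtain ⟨a', ha'⟩ := exists_subdiv_eq j a
      refine ⟨a', fun h hs hv i => ?_⟩
      have hs' := hs.comp_F j
      rw [zero_div] at hs'
      refine ha _ hs' (fun l => ?_) i
      simp only [hs.root, hv, ha']
  obtain ⟨a, ha⟩ := key w
  obtain ⟨h, hc, hs, hv⟩ := exists_subdivides hq 0 a
  exact ⟨h, hc, hs, ha h hs hv⟩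

/-! ### Estimates on the neighboring cells -/

/-- `junction` controls the far corners uniformly in θ ∈ [0, 1]. If j ≠ i₀, all corner values are at
least e/9, which exceeds the possible drop e/12. If j = i₀, the shared corner has value 0 and the
other two at least 4e/27. -/
theorem Subdivides.neighbor_bounds (h : Subdivides q 1 u) (hu : ContinuousOn u (SG q))
    {w w' : List (Fin 3)} {i₀ j : Fin 3}
    (hc : ∀ m, u (Fword q w (q m)) = if m = i₀ then 0 else (1 / 5) ^ w.length / 9)
    (hn : IsNeighbor w j w') {y : Plane} (hy : y ∈ SG q) :
    u (Fword q w' y) ≤ (1 / 5) ^ w.length ∧ -(1 / 5) ^ w.length / 60 ≤ u (Fword q w' y) ∧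
      (j ≠ i₀ → 0 ≤ u (Fword q w' y)) := by
  obtain ⟨τ, i, n, hij, hw, hw'⟩ := hn
  obtain ⟨l, hli, hlj⟩ := exists_third i j hij
  have hlen : w'.length = w.length := by rw [hw, hw']; simp
  obtain ⟨h1, h2, θ, hθ0, hθ1, h3⟩ := h.junction τ hij hli hlj n hw hw'
  have hz := h.comp_Fword w'
  have hzc := continuousOn_comp_Fword hu w'
  rw [one_mul, hlen] at hz
  simp only [hc, one_mul] at h1 h2 h3
  have he : 0 < (1 / 5 : ℝ) ^ w.length := by positivity
  generalize (1 / 5 : ℝ) ^ w.length = e at *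
  have hθe : 0 ≤ θ * e := by positivity
  have hθe' : θ * e ≤ e := by nlinarith
  by_cases hj : j = i₀
  · subst hj
    simp only [if_true, if_neg hij, if_neg hlj] at h1 h2 h3
    have hA : 4 / 27 * e ≤ u (Fword q w' (q j)) := by linarith
    have hB : 4 / 27 * e ≤ u (Fword q w' (q l)) := by linarith
    -- The drop e/12 from the corners of this cell would outweigh the gain e/54. The corners of its
    -- subcells are still nonnegative, and there the drop is only (e/5)/12 = e/60.
    have hlow : ∀ m r, 0 ≤ u (Fword q w' (F q m (q r))) := by
      intro m r
      have hr := hz.root m r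
      rw [hr]
      simp only [subdiv]
      split_ifs with hmr
      · rcases eq_third hij hli hlj m with rfl | rfl | rfl <;> linarith
      · rw [sum_third hij hli hlj]
        rcases eq_third hij hli hlj m with rfl | rfl | rfl <;>
        rcases eq_third hij hli hlj r with rfl | rfl | rfl <;>
        first | exact absurd rfl hmr | linarith
    refine ⟨?_, ?_, fun hne => absurd rfl hne⟩
    · refine (hz.bounds he.le hzc (c := 0) (fun m => ?_) (fun m => ?_) hy).2 <;>
      rcases eq_third hij hli hlj m with rfl | rfl | rfl <;> linarith
    · obtain ⟨m, y', hy', rfl⟩ := exists_F_eq hy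
      obtain ⟨D, hD⟩ := exists_oscBound 0 (fun r => u (Fword q w' (F q m (q r))))
      have := ((hz.comp_F m).bounds (by positivity) (continuousOn_comp_F hzc m) (c := 0)
        (M := u (Fword q w' (F q m (q 0))) + D) (hlow m)
        (fun r => by have := hD r 0; simp only [abs_zero] at this; linarith) hy').1
      linarith
  · have hi₀ : i₀ = i ∨ i₀ = l := by
      rcases eq_third hij hli hlj i₀ with h | h | h
      exacts [Or.inl h, absurd h.symm hj, Or.inr h]
    have hcorner : ∀ m, e / 9 ≤ u (Fword q w' (q m)) ∧ u (Fword q w' (q m)) ≤ e := by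
      rcases hi₀ with rfl | rfl
      · simp only [if_true, if_neg hj, if_neg hli] at h1 h2 h3
        intro m
        rcases eq_third hij hli hlj m with rfl | rfl | rfl <;> constructor <;> linarith
      · simp only [if_true, if_neg hj, if_neg hli.symm] at h1 h2 h3
        intro m
        rcases eq_third hij hli hlj m with rfl | rfl | rfl <;> constructor <;> linarith
    have := hz.bounds he.le hzc (fun m => (hcorner m).1) (fun m => (hcorner m).2) hy
    exact ⟨this.2, by linarith [this.1], fun _ => by linarith [this.1]⟩

/-- The value e/9 is the one for which u vanishes at the midpoints next to corner i₀: (3 · e/9)/5 =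
e/15. The maximum principle on that subcell then gives u ≤ 0. -/
theorem Subdivides.cell_bounds (h : Subdivides q 1 u) (hu : ContinuousOn u (SG q))
    {w : List (Fin 3)} {i₀ : Fin 3}
    (hc : ∀ m, u (Fword q w (q m)) = if m = i₀ then 0 else (1 / 5) ^ w.length / 9)
    {y : Plane} (hy : y ∈ SG q) :
    -(1 / 5) ^ w.length / 12 ≤ u (Fword q w y) ∧ u (Fword q w y) ≤ (1 / 5) ^ w.length ∧
      u (Fword q w (F q i₀ y)) ≤ 0 := by
  have hz := h.comp_Fword w
  have hzc := continuousOn_comp_Fword hu w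
  rw [one_mul] at hz
  have he : 0 < (1 / 5 : ℝ) ^ w.length := by positivity
  generalize (1 / 5 : ℝ) ^ w.length = e at *
  have h1 := hz.bounds he.le hzc (c := 0) (M := e)
    (fun m => by simp only [hc]; split_ifs <;> linarith)
    (fun m => by simp only [hc]; split_ifs <;> linarith) hy
  have h0 : ∀ r, u (Fword q w (F q i₀ (q r))) = 0 := by
    intro r
    have hr := hz.root i₀ r
    simp only [hc] at hr
    rw [hr]
    by_cases h2 : i₀ = r
    · simp [subdiv, h2]
    · obtain ⟨l, hli, hlj⟩ := exists_third i₀ r h2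
      rw [subdiv_of_ne _ h2, sum_third h2 hli hlj]
      simp only [if_true, if_neg (Ne.symm h2), if_neg hli]
      ring
  have h2 := (hz.comp_F i₀).bounds (by positivity) (continuousOn_comp_F hzc i₀) (c := 0) (M := 0)
    (fun r => (h0 r).ge) (fun r => (h0 r).le) hy
  exact ⟨by linarith [h1.1], h1.2, h2.2⟩

theorem Subdivides.integral_cell (h : Subdivides q 1 u) (hu : ContinuousOn u (SG q))
    {w : List (Fin 3)} {i₀ : Fin 3}
    (hc : ∀ m, u (Fword q w (q m)) = if m = i₀ then 0 else (1 / 5) ^ w.length / 9) :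
    ∫ y, u (Fword q w y) ∂(μ q) = (1 / 5) ^ w.length / 54 := by
  have hz := h.comp_Fword w
  rw [one_mul] at hz
  rw [hz.integral_eq (by positivity) (continuousOn_comp_Fword hu w)]
  obtain ⟨j, hj⟩ := exists_ne i₀
  obtain ⟨l, hli, hlj⟩ := exists_third i₀ j hj.symm
  rw [sum_third hj.symm hli hlj]
  simp only [hc, if_true, if_neg hj, if_neg hli]
  ring

/-! ### Sets between a cell and its neighborhood -/

theorem exists_of_mem_D (hq : IsEquilateral q) {w : List (Fin 3)} {x : Plane} (hx : x ∈ D q w) :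
    ∃ w' : List (Fin 3), w'.length = w.length ∧ (w' = w ∨ ∃ j, IsNeighbor w j w') ∧
      ∃ y ∈ SG q, Fword q w' y = x := by
  simp only [D, Set.mem_iUnion] at hx
  obtain ⟨w', ⟨hl, z, ⟨y', hy', h1⟩, y, hy, h2⟩, y'', hy'', rfl⟩ := hx
  refine ⟨w', hl, ?_, y'', hy'', rfl⟩
  by_cases hw : w' = w
  · exact Or.inl hw
  · obtain ⟨j, hj, -⟩ := exists_isNeighbor hq hl.symm (Ne.symm hw) hy hy' (h2.trans h1.symm)
    exact Or.inr ⟨j, hj⟩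

theorem ae_notMem_of_not_isNeighbor (hq : IsEquilateral q) {w w' : List (Fin 3)}
    (hl : w'.length = w.length) (hne : w' ≠ w) (hn : ∀ j, ¬ IsNeighbor w j w') {B : Set Plane}
    (hB : B ⊆ D q w) : ∀ᵐ y ∂(μ q), Fword q w' y ∉ B := by
  filter_upwards [ae_mem_SG q, ae_ne_vertex hq] with y hy hyv hyB
  obtain ⟨w'', hl'', hw'', z, hz, hzy⟩ := exists_of_mem_D hq (hB hyB)
  have hww : w' ≠ w'' := by
    rintro rfl
    rcases hw'' with h | ⟨j, h⟩
    exacts [hne h, hn j h]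
  obtain ⟨j, -, hj, -⟩ := exists_isNeighbor hq (hl.trans hl''.symm) hww hy hz hzy.symm
  exact hyv j hj

theorem sum_isNeighbor_le (w : List (Fin 3)) (m : ℕ) (j : Fin 3) {c : ℝ} (hc : 0 ≤ c)
    [DecidablePred (IsNeighbor w j)] : ∑ w' ∈ words m, (if IsNeighbor w j w' then c else 0) ≤ c := by
  rw [← Finset.sum_filter, Finset.sum_const, nsmul_eq_mul]
  have h : ((words m).filter (IsNeighbor w j)).card ≤ 1 :=
    Finset.card_le_one.2 fun a ha b hb =>
      (Finset.mem_filter.1 ha).2.unique (Finset.mem_filter.1 hb).2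
  have h' : (((words m).filter (IsNeighbor w j)).card : ℝ) ≤ 1 := by exact_mod_cast h
  nlinarith

theorem setIntegral_eq_sum_words {B : Set Plane} (hB : MeasurableSet B) {f : Plane → ℝ}
    (hf : Integrable f (μ q)) (m : ℕ) :
    ∫ x in B, f x ∂(μ q) =
      (1 / 3) ^ m * ∑ w ∈ words m, ∫ y, B.indicator f (Fword q w y) ∂(μ q) := by
  rw [← integral_indicator hB, integral_μ_eq_sum_words (hf.indicator hB) m]

/-- Up to null sets, B lies in C_w and at most one neighbor per corner: at most 1 + 3 cells. -/
theorem measure_bounds (hq : IsEquilateral q) {w : List (Fin 3)} {B : Set Plane}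
    (hB : MeasurableSet B) (hwB : cell q w ⊆ B) (hBD : B ⊆ D q w) :
    0 < (μ q).real B ∧ (μ q).real B ≤ 4 * (1 / 3) ^ w.length := by
  classical
  have e : (μ q).real B = (1 / 3) ^ w.length *
      ∑ w' ∈ words w.length, ∫ y, B.indicator (fun _ => (1 : ℝ)) (Fword q w' y) ∂(μ q) := by
    rw [← setIntegral_eq_sum_words hB (integrable_const 1)]
    simp
  have h0 : ∀ w' : List (Fin 3), ∀ y,
      0 ≤ B.indicator (fun _ => (1 : ℝ)) (Fword q w' y) := fun w' y =>
    Set.indicator_nonneg (fun _ _ => zero_le_one) _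
  have hw : ∫ y, B.indicator (fun _ => (1 : ℝ)) (Fword q w y) ∂(μ q) = 1 := by
    have : ∀ᵐ y ∂(μ q), B.indicator (fun _ => (1 : ℝ)) (Fword q w y) = 1 := by
      filter_upwards [ae_mem_SG q] with y hy
      exact Set.indicator_of_mem (hwB ⟨y, hy, rfl⟩) _
    rw [integral_congr_ae this]
    simp
  have hle1 : ∀ w' : List (Fin 3),
      ∫ y, B.indicator (fun _ => (1 : ℝ)) (Fword q w' y) ∂(μ q) ≤ 1 := by
    intro w'
    have := integral_mono
      (integrable_comp_Fword ((integrable_const (1 : ℝ)).indicator hB) w') (integrable_const (1 : ℝ))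
      (fun y => Set.indicator_le' (f := fun _ => (1 : ℝ)) (g := fun _ => 1) (fun _ _ => le_rfl)
        (fun _ _ => zero_le_one) (Fword q w' y))
    simpa using this
  rw [e]
  constructor
  · refine mul_pos (by positivity) (lt_of_lt_of_le zero_lt_one ?_)
    exact hw.ge.trans (Finset.single_le_sum
      (f := fun w' => ∫ y, B.indicator (fun _ => (1 : ℝ)) (Fword q w' y) ∂(μ q))
      (fun w' _ => integral_nonneg (h0 w')) (mem_words.2 rfl))
  · rw [mul_comm]
    refine mul_le_mul_of_nonneg_right ?_ (by positivity)
    calc ∑ w' ∈ words w.length, ∫ y, B.indicator (fun _ => (1 : ℝ)) (Fword q w' y) ∂(μ q)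
        ≤ ∑ w' ∈ words w.length,
          ((if w' = w then (1 : ℝ) else 0) + ∑ j, if IsNeighbor w j w' then (1 : ℝ) else 0) := by
          refine Finset.sum_le_sum fun w' hw' => ?_
          have hnn : ∀ j, (0 : ℝ) ≤ if IsNeighbor w j w' then (1 : ℝ) else 0 := fun j => by
            split_ifs <;> norm_num
          by_cases hww : w' = w
          · rw [if_pos hww]
            linarith [hle1 w', Finset.sum_nonneg fun j (_ : j ∈ Finset.univ) => hnn j]
          · rw [if_neg hww, zero_add]
            by_cases hn : ∃ j, IsNeighbor w j w'
            · obtain ⟨j, hj⟩ := hn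
              refine (hle1 w').trans ?_
              have := Finset.single_le_sum (f := fun j => if IsNeighbor w j w' then (1 : ℝ) else 0)
                (fun j _ => hnn j) (Finset.mem_univ j)
              rwa [if_pos hj] at this
            · push Not at hn
              have h1 : ∀ᵐ y ∂(μ q), B.indicator (fun _ => (1 : ℝ)) (Fword q w' y) = 0 := by
                filter_upwards [ae_notMem_of_not_isNeighbor hq (mem_words.1 hw') hww hn hBD]
                  with y hy
                exact Set.indicator_of_notMem hy _
              rw [integral_congr_ae h1, integral_zero]
              exact Finset.sum_nonneg fun j _ => hnn j
      _ ≤ 1 + ∑ _j : Fin 3, (1 : ℝ) := by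
          rw [Finset.sum_add_distrib, Finset.sum_comm]
          refine add_le_add ?_ (Finset.sum_le_sum fun j _ => sum_isNeighbor_le w _ j zero_le_one)
          rw [Finset.sum_ite_eq' (words w.length) w]
          split_ifs <;> norm_num
      _ = 4 := by norm_num

/-- The lower bound for the integral over a set between a cell and its neighborhood. -/
theorem Subdivides.le_setIntegral (hq : IsEquilateral q) (h : Subdivides q 1 u)
    (hu : ContinuousOn u (SG q)) {w : List (Fin 3)} {i₀ : Fin 3}
    (hc : ∀ m, u (Fword q w (q m)) = if m = i₀ then 0 else (1 / 5) ^ w.length / 9)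
    {B : Set Plane} (hB : MeasurableSet B) (hwB : cell q w ⊆ B) (hBD : B ⊆ D q w) {t : ℝ}
    (ht : t ≤ 0) :
    (1 / 3) ^ w.length * ((1 / 5) ^ w.length / 540) ≤ ∫ x in B, (u x - t) ∂(μ q) := by
  classical
  have hi : Integrable (fun x => u x - t) (μ q) :=
    (integrable_of_continuousOn hu).sub (integrable_const t)
  rw [setIntegral_eq_sum_words hB hi w.length]
  refine mul_le_mul_of_nonneg_left ?_ (by positivity)
  have he : 0 < (1 / 5 : ℝ) ^ w.length := by positivity
  have hself : (1 / 5 : ℝ) ^ w.length / 54 ≤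
      ∫ y, B.indicator (fun x => u x - t) (Fword q w y) ∂(μ q) := by
    have h1 : ∀ᵐ y ∂(μ q), B.indicator (fun x => u x - t) (Fword q w y) = u (Fword q w y) - t := by
      filter_upwards [ae_mem_SG q] with y hy
      exact Set.indicator_of_mem (hwB ⟨y, hy, rfl⟩) _
    rw [integral_congr_ae h1, integral_sub
      (integrable_of_continuousOn (continuousOn_comp_Fword hu w)) (integrable_const t),
      h.integral_cell hu hc]
    simp only [integral_const, probReal_univ, smul_eq_mul, one_mul]
    linarith
  have hother : ∀ w' ∈ words w.length, w' ≠ w →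
      -(if IsNeighbor w i₀ w' then (1 / 5 : ℝ) ^ w.length / 60 else 0) ≤
        ∫ y, B.indicator (fun x => u x - t) (Fword q w' y) ∂(μ q) := by
    intro w' hw' hne
    by_cases hn : ∃ j, IsNeighbor w j w'
    · obtain ⟨j, hj⟩ := hn
      have hb : ∀ y ∈ SG q, -(if IsNeighbor w i₀ w' then (1 / 5 : ℝ) ^ w.length / 60 else 0) ≤
          B.indicator (fun x => u x - t) (Fword q w' y) := by
        intro y hy
        obtain ⟨-, h2, h3⟩ := h.neighbor_bounds hu hc hj hy
        rw [Set.indicator_apply]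
        by_cases hj0 : IsNeighbor w i₀ w'
        · rw [if_pos hj0]
          split_ifs <;> linarith
        · have := h3 fun e => hj0 (e ▸ hj)
          rw [if_neg hj0]
          split_ifs <;> linarith
      have := integral_mono_ae (integrable_const _) (integrable_comp_Fword (hi.indicator hB) w')
        ((ae_mem_SG q).mono fun y hy => hb y hy)
      simpa using this
    · push Not at hn
      have h1 : ∀ᵐ y ∂(μ q), B.indicator (fun x => u x - t) (Fword q w' y) = 0 := by
        filter_upwards [ae_notMem_of_not_isNeighbor hq (mem_words.1 hw') hne hn hBD] with y hy
        exact Set.indicator_of_notMem hy _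
      rw [integral_congr_ae h1, integral_zero, if_neg (hn i₀), neg_zero]
  rw [← Finset.add_sum_erase _ _ (mem_words.2 rfl : w ∈ words w.length)]
  have hsum : -((1 / 5 : ℝ) ^ w.length / 60) ≤ ∑ w' ∈ (words w.length).erase w,
      ∫ y, B.indicator (fun x => u x - t) (Fword q w' y) ∂(μ q) := by
    calc -((1 / 5 : ℝ) ^ w.length / 60)
        ≤ -∑ w' ∈ (words w.length).erase w,
          (if IsNeighbor w i₀ w' then (1 / 5 : ℝ) ^ w.length / 60 else 0) := by
          refine neg_le_neg ((Finset.sum_le_sum_of_subset_of_nonneg (Finset.erase_subset _ _)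
            fun w' _ _ => ?_).trans (sum_isNeighbor_le w w.length i₀ (by positivity)))
          split_ifs <;> positivity
      _ ≤ _ := by
          rw [← Finset.sum_neg_distrib]
          exact Finset.sum_le_sum fun w' hw' =>
            hother w' (Finset.mem_of_mem_erase hw') (Finset.ne_of_mem_erase hw')
  -- The constant is 1/54 - 1/60 = 1/540.
  linarith

theorem Subdivides.le_of_mem_D (hq : IsEquilateral q) (h : Subdivides q 1 u)
    (hu : ContinuousOn u (SG q)) {w : List (Fin 3)} {i₀ : Fin 3}
    (hc : ∀ m, u (Fword q w (q m)) = if m = i₀ then 0 else (1 / 5) ^ w.length / 9)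
    {x : Plane} (hx : x ∈ D q w) : u x ≤ (1 / 5) ^ w.length := by
  obtain ⟨w', -, rfl | ⟨j, hj⟩, y, hy, rfl⟩ := exists_of_mem_D hq hx
  · exact (h.cell_bounds hu hc hy).2.1
  · exact (h.neighbor_bounds hu hc hj hy).1

/-- The two-sided estimate for functions with Laplacian `1`. -/
theorem IsMeanValueNeighborhoodAt.mean_sub_bounds (hq : IsEquilateral q) {v : Plane → ℝ}
    (hv : HasLaplacian q v fun _ => 1) {x : Plane} {w : List (Fin 3)} {B : Set Plane}
    (hB : IsMeanValueNeighborhoodAt q x w B) :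
    1 / 2160 * (1 / 5) ^ w.length ≤ mean q B v - v x ∧
      mean q B v - v x ≤ 2 * (1 / 5) ^ w.length := by
  obtain ⟨⟨x', hx', rfl⟩, -, hBm, hwB, hBD, hmean⟩ := hB
  -- The corner i₀ is chosen so that x lies in the subcell of C_w at that corner.
  obtain ⟨i₀, x'', hx'', rfl⟩ := exists_F_eq hx'
  obtain ⟨h, hhc, hhs, hhv⟩ := exists_harmonic_corner_eq hq w fun m =>
    v (Fword q w (q m)) - if m = i₀ then 0 else (1 / 5) ^ w.length / 9
  have hvc : ContinuousOn v (SG q) := hv.2.1.1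
  set u : Plane → ℝ := fun y => v y - h y with hudef
  have hu : Subdivides q 1 u := by
    have := (hv.subdivides hq).sub hhs
    rwa [sub_zero] at this
  have huc : ContinuousOn u (SG q) := hvc.sub hhc
  have hcorner : ∀ m, u (Fword q w (q m)) = if m = i₀ then 0 else (1 / 5) ^ w.length / 9 :=
    fun m => by simp only [hudef, hhv]; ring
  have hm := hmean h (hhs.isHarmonic hq hhc)
  obtain ⟨hpos, hle⟩ := measure_bounds hq hBm hwB hBD
  set x := Fword q w (F q i₀ x'') with hx
  have ht : u x ≤ 0 := (hu.cell_bounds huc hcorner hx'').2.2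
  have ht' : -(1 / 5) ^ w.length / 12 ≤ u x := (hu.cell_bounds huc hcorner hx').1
  have hlow := hu.le_setIntegral hq huc hcorner hBm hwB hBD ht
  have hvi := (integrable_of_continuousOn hvc).integrableOn (s := B)
  have hhi := (integrable_of_continuousOn hhc).integrableOn (s := B)
  have hui := (integrable_of_continuousOn huc).integrableOn (s := B)
  have hci : IntegrableOn (fun _ => u x) B (μ q) := (integrable_const _).integrableOn
  have hint : ∫ y in B, (u y - u x) ∂(μ q) =
      ∫ y in B, v y ∂(μ q) - ∫ y in B, h y ∂(μ q) - (μ q).real B * u x := by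
    rw [integral_sub hui hci, setIntegral_const, smul_eq_mul]
    congr 1
    exact integral_sub hvi hhi
  have hkey : mean q B v - v x = ((μ q).real B)⁻¹ * ∫ y in B, (u y - u x) ∂(μ q) := by
    have hcancel : ((μ q).real B)⁻¹ * (μ q).real B = 1 := inv_mul_cancel₀ hpos.ne'
    rw [hint, mul_sub, mul_sub, ← mul_assoc, hcancel, one_mul]
    have h1 : ((μ q).real B)⁻¹ * ∫ y in B, h y ∂(μ q) = h x := hm
    rw [h1]
    simp only [mean, hudef]
    ring
  rw [hkey]
  constructor
  · rw [inv_mul_eq_div, le_div_iff₀ hpos]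
    refine le_trans ?_ hlow
    -- Here 2160 = 4 · 540.
    calc 1 / 2160 * (1 / 5 : ℝ) ^ w.length * (μ q).real B
        ≤ 1 / 2160 * (1 / 5 : ℝ) ^ w.length * (4 * (1 / 3) ^ w.length) :=
          mul_le_mul_of_nonneg_left hle (by positivity)
      _ = _ := by ring
  · rw [inv_mul_eq_div, div_le_iff₀ hpos]
    have hup : ∫ y in B, (u y - u x) ∂(μ q) ≤ ∫ _y in B, 2 * (1 / 5 : ℝ) ^ w.length ∂(μ q) := by
      refine setIntegral_mono_on (hui.sub hci) (integrable_const _).integrableOn hBm fun y hy => ?_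
      have := hu.le_of_mem_D hq huc hcorner (hBD hy)
      have he : 0 < (1 / 5 : ℝ) ^ w.length := by positivity
      -- On B, u y - u x ≤ e + e/12 ≤ 2e.
      linarith
    rw [setIntegral_const, smul_eq_mul, mul_comm] at hup
    exact hup

end

end SierpinskiGasket

end

theorem theorem4p1 (q : Fin 3 → SierpinskiGasket.Plane) (hq : SierpinskiGasket.IsEquilateral q) :
    (∃ v : SierpinskiGasket.Plane → ℝ, SierpinskiGasket.HasLaplacian q v fun _ => 1) ∧
    ∃ c₀ c₁ : ℝ, 0 < c₀ ∧
      ∀ v : SierpinskiGasket.Plane → ℝ, SierpinskiGasket.HasLaplacian q v (fun _ => 1) →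
      ∀ x ∈ SierpinskiGasket.SG q, x ∉ SierpinskiGasket.V q 0 →
      ∀ (k : ℕ) (B : Set SierpinskiGasket.Plane),
        SierpinskiGasket.IsMeanValueNeighborhood q x k B →
        c₀ * (1 / 5) ^ k ≤ SierpinskiGasket.mean q B v - v x ∧
          SierpinskiGasket.mean q B v - v x ≤ c₁ * (1 / 5) ^ k := by
  constructor
  · obtain ⟨v, hvc, hvs, -⟩ := SierpinskiGasket.exists_subdivides hq 1 0
    exact ⟨v, hvs.hasLaplacian hq hvc⟩
  · refine ⟨1 / 2160, 2, by norm_num, fun v hv x _ _ k B hB => ?_⟩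
    obtain ⟨w, rfl, hw⟩ := hB
    exact hw.mean_sub_bounds hq hv
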